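/- **Setting.** Let $m\ge 2$ and $b\ge 2$ be integers, $\varepsilon_1,\varepsilon_2>0$, $\ell\ge 1$ real, $h=\lceil \ell/2\rceil$, $0<\gamma\le 1$, and let $\log$ denote the logarithm to base $2$. A dataset is a finite multiset $X$ of points of $[0,b]$, with order statistics $x_{(1)}\le\dots\le x_{(|X|)}$ and the conventions $x_{(i)}=0$ for $i\le 0$ and $x_{(i)}=b$ for $i>|X|$. Two datasets are *add/remove adjacent* if one arises from the other by adding one point, and *substitute adjacent* if one arises from the other by changing one point. A mechanism $M$ is $\varepsilon$-*pure differentially private* for an adjacency relation if $\Pr[M(X)\in E]\le e^{\varepsilon}\Pr[M(X')\in E]$ for all adjacent admissible inputs $X,X'$ and all measurable $E$. For real $t$ put $$\mathsf{Good}_{m,n,t}=\{\mathbf r\in\mathbb Z^m:\ t\le r_1,\ r_{i-1}+2t\le r_i\ (2\le i\le m),\ r_m\le n-t\}.$$ **Continual counting.** $\mathsf{CC}_{\varepsilon_1}(\mathbf r)$ is the binary tree mechanism: with $T=\lceil\log(m+1)\rceil$, draw independent Laplace noises $\eta_I$ of scale $T/\varepsilon_1$ for the dyadic intervals $I$, and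 return, for each $i$, the integer nearest to $r_i+\sum_{I}\eta_I$ (half-integers rounded up), the sum being over the intervals $I$ of the binary decomposition of $[0,i)$. **Algorithm.** $\mathsf{SliceQuantiles}$ has the fixed parameters $\mathbf r\in\mathbb Z^m$, $w,\varepsilon_1,\ell,\gamma,b$, a permutation $\pi$ of $\{1,\dots,m\}$, and an algorithm $\mathsf{SingleQuantile}$. The admissible inputs are the datasets $X$ with $\mathbf r\in\mathsf{Good}_{m,|X|,\,w+h+1}$. On input $X$ it draws $\tilde{\mathbf r}=\mathsf{CC}_{\varepsilon_1}(\mathbf r)$ and, independently, a coin with heads probability $\gamma$. If the coin is heads or $\tilde{\mathbf r}\notin\mathsf{Good}_{m,|X|,h}$, it returns $m$ independent uniform samples from $(0,b)$. Otherwise, for $i=1,\dots,m$ it sets $j=\pi(i)$, forms the slice $S_j=\{x_{(\tilde r_j-h)},\dots,x_{(\tilde r_j+h)}\}$, lets $a_j$ (resp. $b_j$) be the estimate already released at the nearest index below (resp. above) $j$, or $0$ (resp. $b$) if there is none, and draws $z_j$ from $\mathsf{SingleQuantile}$ run with target rank $\lfloor |S_j|/2\rfloor$ on $S_j$, given the previously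 released estimates, $\pi$ and the range $(a_j,b_j)$; it returns $(z_1,\dots,z_m)$. Here $\mathsf{SingleQuantile}$ is any randomized algorithm with outputs in $(0,b)$ which, for every fixed value of its other arguments, is $\varepsilon_2$-pure differentially private in its dataset under substitute adjacency. **Statement.** Let every estimate $z_i$ returned by $\mathsf{SliceQuantiles}$ be rounded to the nearest integer. 1. With $$w=\frac{3\log m}{\varepsilon_1}\left(m\log b+\log\frac{2m}{\gamma\,(e^{\varepsilon_2}-1)}\right),$$ the resulting mechanism is $(\varepsilon_1+2\varepsilon_2)$-pure differentially private under add/remove adjacency. 2. With $$w=\frac{3\log m}{\varepsilon_1}\left(m\log b+\log\frac{2m}{\gamma\,(e^{\varepsilon_1}-1)}+\varepsilon_1+2\varepsilon_2\right),$$ the resulting mechanism is $(2\varepsilon_1+3\varepsilon_2)$-pure differentially private under substitute adjacency. -/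

import Mathlib

open MeasureTheory ProbabilityTheory
open scoped ENNReal

noncomputable section

namespace DPQuantiles

/-! ### Datasets, adjacency and pure differential privacy -/

/-- Add/remove adjacency: one of the two datasets (finite multisets of reals) is obtained from the
other by adding a single point. -/
def AddRemoveAdj (X X' : Multiset ℝ) : Prop :=
  (∃ x : ℝ, X' = x ::ₘ X) ∨ (∃ x : ℝ, X = x ::ₘ X')

/-- Substitute adjacency: the datasets have the same size, and one is obtained from the other by
changing one point. -/
def SubstituteAdj (X X' : Multiset ℝ) : Prop :=
  ∃ (Y : Multiset ℝ) (x x' : ℝ), X = x ::ₘ Y ∧ X' = x' ::ₘ Y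

/-- The datasets all of whose points lie in the data domain `[0, b]`. -/
def InDomain (b : ℕ) : Set (Multiset ℝ) :=
  {X | ∀ x ∈ X, x ∈ Set.Icc (0 : ℝ) b}

/-- `ε`-pure differential privacy of the randomized mechanism `M` (given by its output laws) on the
admissible inputs `dom`, with respect to the adjacency relation `adj`. -/
def IsPureDP {Y : Type*} [MeasurableSpace Y] (adj : Multiset ℝ → Multiset ℝ → Prop)
    (dom : Set (Multiset ℝ)) (M : Multiset ℝ → Measure Y) (ε : ℝ) : Prop :=
  ∀ X ∈ dom, ∀ X' ∈ dom, adj X X' →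
    ∀ E : Set Y, MeasurableSet E → M X E ≤ ENNReal.ofReal (Real.exp ε) * M X' E

/-! ### Continual counting: the binary tree mechanism with rounding -/

/-- The centred Laplace distribution with scale `s > 0`. -/
def laplaceMeasure (s : ℝ) : Measure ℝ :=
  volume.withDensity fun x => ENNReal.ofReal (Real.exp (-|x| / s) / (2 * s))

/-- `T = ⌈log₂ (m + 1)⌉`, the number of levels of the tree that are used. -/
def treeDepth (m : ℕ) : ℕ := Nat.clog 2 (m + 1)

/-- The nodes of the tree: `(l, k)` stands for the dyadic interval `[k * 2 ^ l, (k + 1) * 2 ^ l)`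
(only those needed to decompose the prefixes of `[0, m)` are ever read). -/
abbrev TreeNode (m : ℕ) : Type := Fin (treeDepth m) × Fin m

/-- The noise added to the `i`-th rank (counting from `0`): the sum of the noises of the nodes in
the dyadic decomposition of the prefix `[0, p)`, where `p = i + 1`. This decomposition has one
interval `[(p / 2 ^ l - 1) * 2 ^ l, (p / 2 ^ l) * 2 ^ l)` for each binary digit `1` of `p`,
at position `l`. -/
def prefixNoise (m : ℕ) (η : TreeNode m → ℝ) (i : Fin m) : ℝ :=
  ∑ l : Fin (treeDepth m),
    if (i.val + 1).testBit l.val then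
      η (l, ⟨(i.val + 1) / 2 ^ l.val - 1, by
        have h1 := Nat.div_le_self (i.val + 1) (2 ^ l.val)
        have h2 := i.isLt
        omega⟩)
    else 0

/-- The law of the noisy integer ranks `CC_ε(r₁, …, rₘ)`: independent Laplace noise of scale `T / ε`
on every node; each rank receives its prefix noise and is rounded to the nearest integer
(half-integers are rounded up). -/
def continualCounting (m : ℕ) (ε : ℝ) (r : Fin m → ℤ) : Measure (Fin m → ℤ) :=
  (Measure.pi fun _ : TreeNode m => laplaceMeasure (treeDepth m / ε)).map
    fun η i => round ((r i : ℝ) + prefixNoise m η i)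

/-! ### Slices -/

/-- `Good m n h`: rank vectors with enough space around each rank, i.e. `h ≤ r₁`,
`rᵢ₋₁ + 2 h ≤ rᵢ` for consecutive ranks, and `rₘ ≤ n - h`. -/
def Good (m n : ℕ) (h : ℝ) : Set (Fin m → ℤ) :=
  {r | (∀ i : Fin m, i.val = 0 → h ≤ (r i : ℝ)) ∧
       (∀ i j : Fin m, i.val + 1 = j.val → (r i : ℝ) + 2 * h ≤ (r j : ℝ)) ∧
       (∀ i : Fin m, i.val + 1 = m → (r i : ℝ) ≤ (n : ℝ) - h)}

/-- The order statistic `x_(i)`, the `i`-th smallest element of `X` (counting from `1`), with the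
conventions `x_(i) = 0` for `i ≤ 0` and `x_(i) = b` for `i > |X|`. -/
def orderStat (b : ℕ) (X : Multiset ℝ) (i : ℤ) : ℝ :=
  if i ≤ 0 then 0 else (X.sort (· ≤ ·)).getD (i.toNat - 1) b

/-- The slice `x_(r - h), …, x_(r + h)`. -/
def slice (b : ℕ) (X : Multiset ℝ) (r : ℤ) (h : ℕ) : Multiset ℝ :=
  (Finset.Icc (r - (h : ℤ)) (r + (h : ℤ))).val.map (orderStat b X)

/-! ### Range clipping -/

/-- The indices `k` whose estimate has been released before step `t`, when the estimates are
released in the order `π 0, π 1, …`. -/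
def released {m : ℕ} (π : Equiv.Perm (Fin m)) (t : Fin m) : Finset (Fin m) :=
  Finset.univ.filter fun k => π.symm k < t

/-- The range for the estimate released in step `t`: the interval between the estimates at the
nearest indices below and above `π t` that have already been released, with `0` and `b` where there
is none. -/
def clipRange {m : ℕ} (b : ℕ) (π : Equiv.Perm (Fin m)) (t : Fin m) (z : Fin m → ℝ) : ℝ × ℝ :=
  (if h : ((released π t).filter (· < π t)).Nonempty
      then z (((released π t).filter (· < π t)).max' h) else 0,
   if h : ((released π t).filter (π t < ·)).Nonempty
      then z (((released π t).filter (π t < ·)).min' h) else b)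

/-! ### The algorithm -/

/-- A randomized algorithm for estimating a single quantile, as it is called inside a procedure
that releases `m` estimates. In `SQ k S π t`, `k` is the target rank, `S` the dataset, `π` the order
of release and `t` the current step; the resulting kernel takes the estimates released so far (with
`0` at the indices not yet released) together with the range `(aⱼ, bⱼ)`, and returns the law of the
estimate. -/
abbrev SingleQuantileAlg (m : ℕ) : Type :=
  ℕ → Multiset ℝ → Equiv.Perm (Fin m) → Fin m → Kernel ((Fin m → ℝ) × (ℝ × ℝ)) ℝ

/-- One step of the release loop: estimate the index `π t` from its slice and record the result. -/
def releaseStep {m : ℕ} (b : ℕ) (SQ : SingleQuantileAlg m) (π : Equiv.Perm (Fin m))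
    (S : Fin m → Multiset ℝ) (t : Fin m) (z : Fin m → ℝ) : Measure (Fin m → ℝ) :=
  (SQ ((S (π t)).card / 2) (S (π t)) π t (z, clipRange b π t z)).map
    fun y => Function.update z (π t) y

/-- The release loop: all `m` estimates, released in the order `π`, from the slices `S`. -/
def releaseAll {m : ℕ} (b : ℕ) (SQ : SingleQuantileAlg m) (π : Equiv.Perm (Fin m))
    (S : Fin m → Multiset ℝ) : Measure (Fin m → ℝ) :=
  (List.finRange m).foldl (fun μ t => μ.bind (releaseStep b SQ π S t)) (Measure.dirac 0)

/-- `m` independent uniform samples from `(0, b)`. -/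
def uniformOutput (m b : ℕ) : Measure (Fin m → ℝ) :=
  Measure.pi fun _ => cond volume (Set.Ioo (0 : ℝ) b)

open Classical in
/-- The output law of `SliceQuantiles` on the dataset `X` with ranks `r`, budget `ε₁` for continual
counting, list size `ℓ`, probability `γ` of a random output, single-quantile algorithm `SQ` and
release order `π`. (The parameter `w` only enters in the requirement on the input,
see `RequiredInput`.) -/
def sliceQuantiles {m : ℕ} (b : ℕ) (r : Fin m → ℤ) (ε₁ ℓ γ : ℝ) (SQ : SingleQuantileAlg m)
    (π : Equiv.Perm (Fin m)) (X : Multiset ℝ) : Measure (Fin m → ℝ) :=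
  ENNReal.ofReal γ • uniformOutput m b +
  ENNReal.ofReal (1 - γ) • (continualCounting m ε₁ r).bind fun r' =>
    if r' ∈ Good m X.card (⌈ℓ / 2⌉₊ : ℝ)
      then releaseAll b SQ π fun j => slice b X (r' j) ⌈ℓ / 2⌉₊
      else uniformOutput m b

/-- `SliceQuantiles` with every estimate rounded to the nearest integer. -/
def roundedSliceQuantiles {m : ℕ} (b : ℕ) (r : Fin m → ℤ) (ε₁ ℓ γ : ℝ) (SQ : SingleQuantileAlg m)
    (π : Equiv.Perm (Fin m)) (X : Multiset ℝ) : Measure (Fin m → ℤ) :=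
  (sliceQuantiles b r ε₁ ℓ γ SQ π X).map fun z i => round (z i)

/-- The datasets on which `SliceQuantiles` may be run: the points lie in `[0, b]`, and the ranks `r`
belong to `Good m |X| (w + ⌈ℓ / 2⌉ + 1)`. -/
def RequiredInput {m : ℕ} (b : ℕ) (r : Fin m → ℤ) (w ℓ : ℝ) : Set (Multiset ℝ) :=
  {X | X ∈ InDomain b ∧ r ∈ Good m X.card (w + ⌈ℓ / 2⌉₊ + 1)}

/-- `w` for add/remove adjacency. -/
def wAddRemove (m b : ℕ) (ε₁ ε₂ γ : ℝ) : ℝ :=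
  3 * Real.logb 2 m / ε₁ *
    (m * Real.logb 2 b + Real.logb 2 (2 * m / (γ * (Real.exp ε₂ - 1))))

/-- `w` for substitute adjacency. -/
def wSubstitute (m b : ℕ) (ε₁ ε₂ γ : ℝ) : ℝ :=
  3 * Real.logb 2 m / ε₁ *
    (m * Real.logb 2 b + Real.logb 2 (2 * m / (γ * (Real.exp ε₁ - 1))) + ε₁ + 2 * ε₂)

end DPQuantiles

end

noncomputable section

namespace DPQuantiles

/-! ### Laplace noise -/

/-! The noisy ranks for two adjacent datasets are coupled on the event that every noisy rank stays
within `w + 1 / 2` of its true rank; the uniform branch pays for the complement of this event.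

Adding a point inserts one entry, at some position `p`, into the sequence of order statistics. Shift
by one the noisy ranks of all indices whose true rank is at least `p`. Slices away from `p` then
contain the same points as before. The true ranks are so far apart that only one slice can come near
`p`, and it changes by one substitution (`oneSubst_slice_cons`). Removing a point is the same with
the opposite shift. The shift amounts to moving the noise of at most one tree node per level by 1,
which costs `exp ε₁` (`map_suffixShift_continualCounting_le`). In the release loop a single step
reads the changed slice, which costs `exp ε₂` (`releaseAll_le`). A substitution is a removal
followed by an insertion, so both costs double.

Pure privacy leaves no room for an additive failure probability, but rounding makes the set of
outputs finite: an event is either null or contains a grid point, of uniform mass at least `(2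
b)⁻ᵐ`. Both output laws contain `γ` times the same uniform law, so multiplying one of them by `exp
K` leaves a surplus of at least `(exp K - 1) γ (2 b)⁻ᵐ`, which absorbs the failure
(`roundedSliceQuantiles_le_of_coupling`). By a Chernoff bound, `w` is large enough for this, unless
`exp K γ (2 b)⁻ᵐ ≥ 1` and the uniform branch alone gives privacy (`trivial_or_accurate`). -/

lemma measurable_laplaceDensity (s : ℝ) :
    Measurable fun x : ℝ => ENNReal.ofReal (Real.exp (-|x| / s) / (2 * s)) := by
  have : Measurable fun x : ℝ => |x| := continuous_abs.measurable
  fun_prop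

/-- The exponential moments of the Laplace distribution. -/
lemma lintegral_exp_mul_laplaceMeasure {s t : ℝ} (hs : 0 < s) (h1 : t * s < 1) (h2 : -1 < t * s) :
    ∫⁻ x, ENNReal.ofReal (Real.exp (t * x)) ∂(laplaceMeasure s)
      = ENNReal.ofReal (1 / (1 - (t * s) ^ 2)) := by
  have ha : 0 < t + 1 / s := by
    rw [← mul_pos_iff_of_pos_right hs, add_mul, div_mul_cancel₀ _ hs.ne']; linarith
  have hb : t - 1 / s < 0 := by
    have : (t - 1 / s) * s < 0 := by rw [sub_mul, div_mul_cancel₀ _ hs.ne']; linarith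
    by_contra h
    exact absurd (mul_nonneg (not_lt.mp h) hs.le) (not_le.mpr this)
  rw [laplaceMeasure, lintegral_withDensity_eq_lintegral_mul _ (measurable_laplaceDensity s)
    (by fun_prop), ← lintegral_add_compl _ (measurableSet_Iic (a := (0 : ℝ))), Set.compl_Iic]
  have e1 : ∫⁻ x in Set.Iic (0 : ℝ), ((fun x : ℝ => ENNReal.ofReal (Real.exp (-|x| / s) / (2 * s))) *
      fun x => ENNReal.ofReal (Real.exp (t * x))) x
      = ENNReal.ofReal (1 / (2 * s) * (1 / (t + 1 / s))) := by
    have : (∫ x in Set.Iic (0 : ℝ), 1 / (2 * s) * Real.exp ((t + 1 / s) * x))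
        = 1 / (2 * s) * (1 / (t + 1 / s)) := by
      rw [integral_const_mul, integral_exp_mul_Iic ha]; simp
    rw [← this, ofReal_integral_eq_lintegral_ofReal]
    · refine setLIntegral_congr_fun measurableSet_Iic fun x hx => ?_
      simp only [Pi.mul_apply]
      rw [← ENNReal.ofReal_mul (by positivity), abs_of_nonpos hx, div_mul_eq_mul_div, ← Real.exp_add]
      congr 1
      rw [one_div_mul_eq_div]
      congr 2
      ring
    · exact (integrableOn_exp_mul_Iic ha 0).const_mul _
    · exact Filter.Eventually.of_forall fun x => by positivity
  have e2 : ∫⁻ x in Set.Ioi (0 : ℝ), ((fun x : ℝ => ENNReal.ofReal (Real.exp (-|x| / s) / (2 * s))) *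
      fun x => ENNReal.ofReal (Real.exp (t * x))) x
      = ENNReal.ofReal (1 / (2 * s) * (-1 / (t - 1 / s))) := by
    have : (∫ x in Set.Ioi (0 : ℝ), 1 / (2 * s) * Real.exp ((t - 1 / s) * x))
        = 1 / (2 * s) * (-1 / (t - 1 / s)) := by
      rw [integral_const_mul, integral_exp_mul_Ioi hb]; simp
    rw [← this, ofReal_integral_eq_lintegral_ofReal]
    · refine setLIntegral_congr_fun measurableSet_Ioi fun x hx => ?_
      simp only [Pi.mul_apply]
      rw [← ENNReal.ofReal_mul (by positivity), abs_of_pos hx, div_mul_eq_mul_div, ← Real.exp_add]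
      congr 1
      rw [one_div_mul_eq_div]
      congr 2
      ring
    · exact (integrableOn_exp_mul_Ioi hb 0).const_mul _
    · exact Filter.Eventually.of_forall fun x => by positivity
  rw [e1, e2, ← ENNReal.ofReal_add (by positivity)
    (mul_nonneg (by positivity) (div_nonneg_of_nonpos (by norm_num) hb.le))]
  congr 1
  have h3 : t * s + 1 ≠ 0 := by linarith
  have h4 : t * s - 1 ≠ 0 := by linarith
  have e3 : t + 1 / s = (t * s + 1) / s := by field_simp
  have e4 : t - 1 / s = (t * s - 1) / s := by field_simp
  rw [e3, e4, show 1 - (t * s) ^ 2 = -((t * s + 1) * (t * s - 1)) by ring]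
  generalize t * s = u at h3 h4
  field_simp
  ring

lemma isProbabilityMeasure_laplaceMeasure {s : ℝ} (hs : 0 < s) :
    IsProbabilityMeasure (laplaceMeasure s) :=
  ⟨by simpa using lintegral_exp_mul_laplaceMeasure (t := 0) hs (by simp) (by simp)⟩

/-- Translating Laplace noise changes its density by a bounded factor. -/
lemma map_add_laplaceMeasure_le {s : ℝ} (hs : 0 < s) (a : ℝ) :
    (laplaceMeasure s).map (· + a) ≤ ENNReal.ofReal (Real.exp (|a| / s)) • laplaceMeasure s := by
  refine Measure.le_iff.mpr fun E hE => ?_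
  have hf := measurable_laplaceDensity s
  rw [Measure.map_apply (by fun_prop) hE, Measure.smul_apply, smul_eq_mul, laplaceMeasure,
    withDensity_apply _ hE, withDensity_apply _ (hE.preimage (by fun_prop)),
    ← lintegral_indicator hE, ← lintegral_indicator (hE.preimage (by fun_prop)),
    ← lintegral_const_mul _ (hf.indicator hE),
    ← lintegral_add_right_eq_self (fun x => ENNReal.ofReal (Real.exp (|a| / s)) * E.indicator _ x) a]
  refine lintegral_mono fun x => ?_
  by_cases hx : x + a ∈ E
  · rw [Set.indicator_of_mem (show x ∈ (fun y => y + a) ⁻¹' E from hx), Set.indicator_of_mem hx,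
      ← ENNReal.ofReal_mul (by positivity), mul_div_assoc', ← Real.exp_add, ← add_div]
    refine ENNReal.ofReal_le_ofReal ?_
    have := abs_sub_abs_le_abs_sub (x + a) x
    rw [add_sub_cancel_left] at this
    gcongr
    linarith
  · rw [Set.indicator_of_notMem (show x ∉ (fun y => y + a) ⁻¹' E from hx)]
    exact zero_le

/-- The product outer measure is the largest one bounded on boxes by the products of the side
measures, so the domination only has to be checked on boxes. -/
lemma pi_le_prod_smul_pi {ι : Type*} [Fintype ι] (μ ν : ι → Measure ℝ)
    [∀ i, IsProbabilityMeasure (μ i)] [∀ i, IsProbabilityMeasure (ν i)] (c : ι → ℝ≥0∞)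
    (hc : ∀ i, c i ≠ ∞) (h : ∀ i, μ i ≤ c i • ν i) :
    Measure.pi μ ≤ (∏ i, c i) • Measure.pi ν := by
  have hfin : ∀ i, IsFiniteMeasure (c i • ν i) := fun i =>
    ⟨by simpa using lt_top_iff_ne_top.mpr (hc i)⟩
  have e : Measure.pi (fun i => c i • ν i) = (∏ i, c i) • Measure.pi ν := by
    refine Measure.pi_eq (μ := fun i => c i • ν i) fun s _ => ?_
    simp [Measure.pi_pi, Finset.prod_mul_distrib]
  rw [← e]
  have h1 : (Measure.pi μ).toOuterMeasure ≤
      OuterMeasure.pi fun i => (c i • ν i).toOuterMeasure := by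
    refine OuterMeasure.le_pi.mpr fun s _ => ?_
    change Measure.pi μ _ ≤ _
    rw [Measure.pi_pi]
    exact Finset.prod_le_prod' fun i _ => h i (s i)
  refine Measure.le_iff.mpr fun s hs => ?_
  rw [Measure.pi_def (fun i => c i • ν i), toMeasure_apply _ _ hs]
  exact h1 s

/-! ### The binary tree -/

lemma pos_treeDepth {m : ℕ} (hm : 2 ≤ m) : 0 < treeDepth m :=
  Nat.clog_pos (by norm_num) (by omega)

/-- The number of dyadic intervals in the decomposition of `[0, p)` is at most `log₂ (p + 1)`. -/
lemma prod_testBit_le (T p : ℕ) :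
    (∏ l : Fin T, if p.testBit l.val then 2 else 1) ≤ p + 1 := by
  induction T generalizing p with
  | zero => simp
  | succ T ih =>
    rw [Fin.prod_univ_succ]
    -- The lowest digit contributes the factor 2 only for odd `p`, and then `2 * (p / 2 + 1) = p +
    -- 1`.
    have := ih (p / 2)
    have hd : p.testBit 0 = true ↔ p % 2 = 1 := by simp [Nat.testBit_zero]
    simp only [Nat.testBit_succ, hd, Fin.val_zero, Fin.val_succ]
    split_ifs <;> omega

/-- Exactly one dyadic interval in the decomposition of `[0, p)` contains `j < p`. -/
lemma sum_testBit_mem (T p j : ℕ) (hp : p < 2 ^ T) :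
    (∑ l : Fin T, if p.testBit l.val then (if p / 2 ^ l.val - 1 = j / 2 ^ l.val then (1 : ℝ) else 0)
      else 0) = if j < p then 1 else 0 := by
  induction T generalizing p j with
  | zero =>
    have : p = 0 := by simpa using hp
    simp [this]
  | succ T ih =>
    -- Split off the lowest digit: it contributes the interval `{p - 1}` when `p` is odd, and the
    -- higher digits decompose `[0, p / 2)`, where `j` becomes `j / 2`.
    rw [Fin.sum_univ_succ]
    simp only [Fin.val_zero, Fin.val_succ, Nat.testBit_succ, pow_succ', ← Nat.div_div_eq_div_mul,
      pow_zero, Nat.div_one]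
    rw [ih (p / 2) (j / 2) (by rw [pow_succ] at hp; omega), Nat.testBit_zero]
    have hd : decide (p % 2 = 1) = true ↔ p % 2 = 1 := by simp
    simp only [hd]
    split_ifs <;> first | (exfalso; omega) | norm_num

/-- The dyadic intervals that contain `J`, as a vector of unit shifts. -/
def nodeShift (m J : ℕ) (n : TreeNode m) : ℝ := if n.2.val = J / 2 ^ n.1.val then 1 else 0

/-- The prefix `[0, i + 1)` contains `J` exactly when `J ≤ i`, and then exactly one interval of its
decomposition is a shifted node. -/
lemma prefixNoise_add_nodeShift {m : ℕ} (J : ℕ) (a : ℝ) (η : TreeNode m → ℝ) (i : Fin m) :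
    prefixNoise m (fun n => η n + a * nodeShift m J n) i
      = prefixNoise m η i + a * if J ≤ i.val then 1 else 0 := by
  have hlt : i.val + 1 < 2 ^ treeDepth m :=
    (Nat.add_lt_add_right i.isLt 1).trans_le (Nat.le_pow_clog (by norm_num) _)
  have := sum_testBit_mem (treeDepth m) (i.val + 1) J hlt
  simp only [Nat.lt_succ_iff] at this
  rw [← this, prefixNoise, prefixNoise, Finset.mul_sum, ← Finset.sum_add_distrib]
  refine Finset.sum_congr rfl fun l _ => ?_
  split_ifs <;> simp_all [nodeShift]

lemma sum_nodeShift_le (m J : ℕ) : ∑ n : TreeNode m, nodeShift m J n ≤ treeDepth m := by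
  rw [Fintype.sum_prod_type]
  have : ∀ l : Fin (treeDepth m), ∑ k : Fin m, nodeShift m J (l, k) ≤ 1 := by
    intro l
    by_cases h : J / 2 ^ l.val < m
    · rw [Finset.sum_eq_single (⟨J / 2 ^ l.val, h⟩ : Fin m)]
      · simp [nodeShift]
      · intro k _ hk
        simp only [nodeShift]
        rw [if_neg]
        exact fun h' => hk (Fin.ext h')
      · simp
    · rw [Finset.sum_eq_zero]
      · norm_num
      · intro k _
        simp only [nodeShift]
        rw [if_neg]
        have := k.isLt
        omega
  calc _ ≤ ∑ l : Fin (treeDepth m), (1 : ℝ) := Finset.sum_le_sum fun l _ => this l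
    _ = _ := by simp

@[fun_prop]
lemma measurable_prefixNoise (m : ℕ) (i : Fin m) : Measurable fun η => prefixNoise m η i := by
  unfold prefixNoise
  refine Finset.measurable_sum _ fun l _ => ?_
  split_ifs <;> fun_prop

lemma measurable_noisyRanks {m : ℕ} (r : Fin m → ℤ) :
    Measurable fun (η : TreeNode m → ℝ) (i : Fin m) => round ((r i : ℝ) + prefixNoise m η i) :=
  measurable_pi_lambda _ fun i => by
    simp only [round_eq]
    have := measurable_prefixNoise m i
    exact Int.measurable_floor.comp (by fun_prop)

lemma isProbabilityMeasure_continualCounting {m : ℕ} (hm : 2 ≤ m) {ε : ℝ} (hε : 0 < ε)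
    (r : Fin m → ℤ) : IsProbabilityMeasure (continualCounting m ε r) := by
  have hT : (0 : ℝ) < treeDepth m := by exact_mod_cast pos_treeDepth hm
  have := isProbabilityMeasure_laplaceMeasure (div_pos hT hε)
  exact Measure.isProbabilityMeasure_map (measurable_noisyRanks r).aemeasurable

/-- The shift of all ranks from index `J` on by `a`. -/
def suffixShift {m : ℕ} (J : ℕ) (a : ℤ) (r : Fin m → ℤ) (i : Fin m) : ℤ :=
  r i + if J ≤ i.val then a else 0

/-- Privacy of continual counting: shifting the output on a suffix by one has the effect of
changing one item of the stream. -/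
lemma map_suffixShift_continualCounting_le {m : ℕ} (hm : 2 ≤ m) {ε : ℝ} (hε : 0 < ε)
    (r : Fin m → ℤ) (J : ℕ) {a : ℤ} (ha : |a| = 1) :
    (continualCounting m ε r).map (suffixShift J a) ≤
      ENNReal.ofReal (Real.exp ε) • continualCounting m ε r := by
  have hT : (0 : ℝ) < treeDepth m := by exact_mod_cast pos_treeDepth hm
  have hs := div_pos hT hε
  have := isProbabilityMeasure_laplaceMeasure hs
  set s : ℝ := treeDepth m / ε
  set P := Measure.pi fun _ : TreeNode m => laplaceMeasure s
  have ha' : |(a : ℝ)| = 1 := by rw [← Int.cast_abs, ha]; simp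
  have hshift : P.map (fun η n => η n + a * nodeShift m J n) ≤ ENNReal.ofReal (Real.exp ε) • P := by
    have hp : ∀ n : TreeNode m,
        IsProbabilityMeasure ((laplaceMeasure s).map (· + a * nodeShift m J n)) :=
      fun n => Measure.isProbabilityMeasure_map (by fun_prop)
    rw [Measure.pi_map_pi (X := fun _ : TreeNode m => ℝ) (μ := fun _ => laplaceMeasure s)
      (f := fun n x => x + a * nodeShift m J n) (fun n => by fun_prop)]
    refine (pi_le_prod_smul_pi _ _ _ (fun n => ENNReal.ofReal_ne_top)
      fun n => map_add_laplaceMeasure_le hs _).trans ?_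
    rw [← ENNReal.ofReal_prod_of_nonneg (fun _ _ => by positivity), ← Real.exp_sum]
    have hsum : ∑ n : TreeNode m, |(a : ℝ) * nodeShift m J n| / s ≤ ε := by
      have h0 : ∀ n : TreeNode m, |(a : ℝ) * nodeShift m J n| = nodeShift m J n := by
        intro n
        rw [abs_mul, ha', one_mul, abs_of_nonneg]
        unfold nodeShift
        split_ifs <;> norm_num
      simp only [h0]
      rw [← Finset.sum_div, div_le_iff₀ hs]
      calc _ ≤ (treeDepth m : ℝ) := sum_nodeShift_le m J
        _ = ε * s := by simp only [s]; field_simp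
    refine Measure.le_iff.mpr fun E _ => ?_
    rw [Measure.smul_apply, Measure.smul_apply]
    exact mul_le_mul_left (ENNReal.ofReal_le_ofReal (Real.exp_le_exp.mpr hsum)) _
  rw [continualCounting, Measure.map_map (measurable_of_countable _) (measurable_noisyRanks r)]
  -- An integer shift commutes with rounding, so the shift of the output can be moved onto the
  -- noise.
  have e : (suffixShift J a ∘ fun (η : TreeNode m → ℝ) i => round ((r i : ℝ) + prefixNoise m η i))
      = (fun η i => round ((r i : ℝ) + prefixNoise m η i)) ∘
        fun η n => η n + a * nodeShift m J n := by
    funext η i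
    simp only [Function.comp, suffixShift]
    rw [prefixNoise_add_nodeShift, ← add_assoc]
    split_ifs
    · rw [mul_one, round_add_intCast]
    · simp
  rw [e, ← Measure.map_map (measurable_noisyRanks r) (by fun_prop), ← Measure.map_smul]
  exact Measure.map_mono hshift (measurable_noisyRanks r)

/-- Exponential moments of the prefix noise. -/
lemma lintegral_exp_prefixNoise_le {m : ℕ} {s t : ℝ} (hs : 0 < s) (ht : (t * s) ^ 2 = 1 / 2)
    (i : Fin m) :
    ∫⁻ η, ENNReal.ofReal (Real.exp (t * prefixNoise m η i))
      ∂(Measure.pi fun _ : TreeNode m => laplaceMeasure s) ≤ ((i.val + 2 : ℕ) : ℝ≥0∞) := by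
  have := isProbabilityMeasure_laplaceMeasure hs
  set P := Measure.pi fun _ : TreeNode m => laplaceMeasure s
  let g : Fin (treeDepth m) → TreeNode m := fun l => (l, ⟨(i.val + 1) / 2 ^ l.val - 1, by
        have h1 := Nat.div_le_self (i.val + 1) (2 ^ l.val)
        have h2 := i.isLt
        omega⟩)
  -- Distinct levels read distinct nodes, hence independent noises.
  have hg : Function.Injective g := fun l l' h => (Prod.mk.inj h).1
  let F : Fin (treeDepth m) → ℝ → ℝ≥0∞ := fun l x =>
    if (i.val + 1).testBit l.val then ENNReal.ofReal (Real.exp (t * x)) else 1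
  have hF : ∀ l, Measurable (F l) := by
    intro l
    simp only [F]
    split_ifs <;> fun_prop
  have hind : iIndepFun (fun l (η : TreeNode m → ℝ) => F l (η (g l))) P :=
    ((iIndepFun_pi (μ := fun _ : TreeNode m => laplaceMeasure s) (X := fun _ => id)
      (fun _ => aemeasurable_id)).precomp hg).comp F hF
  have e : ∀ η : TreeNode m → ℝ, ENNReal.ofReal (Real.exp (t * prefixNoise m η i))
      = ∏ l, F l (η (g l)) := by
    intro η
    rw [prefixNoise, Finset.mul_sum, Real.exp_sum,
      ENNReal.ofReal_prod_of_nonneg (fun _ _ => by positivity)]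
    refine Finset.prod_congr rfl fun l _ => ?_
    simp only [F, g]
    split_ifs <;> simp
  simp only [e]
  rw [lintegral_prod_eq_prod_lintegral_of_indepFun _ _ hind
    (fun l => (hF l).comp (measurable_pi_apply _))]
  have h1 : |t * s| < 1 := by
    rw [← sq_lt_one_iff_abs_lt_one, ht]; norm_num
  have hle := prod_testBit_le (treeDepth m) (i.val + 1)
  refine le_trans (le_of_eq ?_) (Nat.cast_le.mpr hle)
  rw [Nat.cast_prod]
  refine Finset.prod_congr rfl fun l _ => ?_
  have hev : ∫⁻ η, F l (η (g l)) ∂P = ∫⁻ x, F l x ∂(laplaceMeasure s) :=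
    (measurePreserving_eval (fun _ : TreeNode m => laplaceMeasure s) (g l)).lintegral_comp (hF l)
  rw [hev]
  simp only [F]
  split_ifs
  -- With `(t s)² = 1 / 2` the moment is exactly 2, the factor counted in `prod_testBit_le`.
  · rw [lintegral_exp_mul_laplaceMeasure hs (abs_lt.mp h1).2 (abs_lt.mp h1).1, ht]
    norm_num
  · simp

/-- Chernoff bound for the noise of one rank. -/
lemma measure_lt_abs_prefixNoise_le {m : ℕ} {s t : ℝ} (hs : 0 < s) (ht0 : 0 < t)
    (ht : (t * s) ^ 2 = 1 / 2) (w : ℝ) (i : Fin m) :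
    (Measure.pi fun _ : TreeNode m => laplaceMeasure s) {η | w < |prefixNoise m η i|} ≤
      ENNReal.ofReal (2 * (i.val + 2) * Real.exp (-(t * w))) := by
  set P := Measure.pi fun _ : TreeNode m => laplaceMeasure s
  -- Used with `u = t` and `u = -t` for the two tails.
  have key : ∀ u : ℝ, (u * s) ^ 2 = 1 / 2 → P {η | t * w ≤ u * prefixNoise m η i} ≤
      ENNReal.ofReal ((i.val + 2) * Real.exp (-(t * w))) := by
    intro u hu
    have h1 := (mul_meas_ge_le_lintegral₀ (μ := P)
      (f := fun η => ENNReal.ofReal (Real.exp (u * prefixNoise m η i)))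
      (by have := measurable_prefixNoise m i; fun_prop) (ENNReal.ofReal (Real.exp (t * w)))).trans
      (lintegral_exp_prefixNoise_le hs hu i)
    have h2 : {η | ENNReal.ofReal (Real.exp (t * w)) ≤
        ENNReal.ofReal (Real.exp (u * prefixNoise m η i))} = {η | t * w ≤ u * prefixNoise m η i} := by
      ext η
      simp only [Set.mem_ofPred_eq]
      rw [ENNReal.ofReal_le_ofReal_iff (by positivity), Real.exp_le_exp]
    rw [h2, mul_comm, ← ENNReal.le_div_iff_mul_le (Or.inl (by simp [Real.exp_pos]))
      (Or.inl ENNReal.ofReal_ne_top)] at h1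
    refine h1.trans (le_of_eq ?_)
    rw [← ENNReal.ofReal_natCast, ← ENNReal.ofReal_div_of_pos (Real.exp_pos _), Real.exp_neg]
    push_cast
    rfl
  have hsub : {η : TreeNode m → ℝ | w < |prefixNoise m η i|} ⊆
      {η | t * w ≤ t * prefixNoise m η i} ∪ {η | t * w ≤ (-t) * prefixNoise m η i} := by
    intro η hη
    rcases lt_abs.mp (Set.mem_ofPred_eq ▸ hη) with h | h
    · exact Or.inl (mul_le_mul_of_nonneg_left h.le ht0.le)
    · right
      change t * w ≤ (-t) * prefixNoise m η i
      rw [neg_mul_comm]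
      exact mul_le_mul_of_nonneg_left h.le ht0.le
  calc P _ ≤ _ := (measure_mono hsub).trans (measure_union_le _ _)
    _ ≤ _ := add_le_add (key t ht) (key (-t) (by rw [neg_mul, neg_sq, ht]))
    _ = _ := by
      rw [← ENNReal.ofReal_add (by positivity) (by positivity)]
      congr 1
      ring

/-- The noisy ranks that are within `w`, up to rounding, of the given ranks. -/
def nearRanks {m : ℕ} (r : Fin m → ℤ) (w : ℝ) : Set (Fin m → ℤ) :=
  {r' | ∀ i, |(r' i : ℝ) - r i| ≤ w + 1 / 2}

/-- Accuracy of continual counting. -/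
lemma continualCounting_compl_nearRanks_le {m : ℕ} (hm : 2 ≤ m) {ε : ℝ} (hε : 0 < ε)
    (r : Fin m → ℤ) (w : ℝ) :
    continualCounting m ε r (nearRanks r w)ᶜ ≤
      ENNReal.ofReal (m * (m + 3) * Real.exp (-(w * ε / (Real.sqrt 2 * treeDepth m)))) := by
  have hT : (0 : ℝ) < treeDepth m := by exact_mod_cast pos_treeDepth hm
  have hs := div_pos hT hε
  have := isProbabilityMeasure_laplaceMeasure hs
  rw [continualCounting, Measure.map_apply (measurable_noisyRanks r) (Set.to_countable _).measurableSet]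
  set P := Measure.pi fun _ : TreeNode m => laplaceMeasure (treeDepth m / ε)
  set t : ℝ := ε / (Real.sqrt 2 * treeDepth m) with ht_def
  have ht0 : 0 < t := by positivity
  have ht : (t * (treeDepth m / ε)) ^ 2 = 1 / 2 := by
    have : t * (treeDepth m / ε) = 1 / Real.sqrt 2 := by rw [ht_def]; field_simp
    rw [this, div_pow, Real.sq_sqrt (by norm_num)]
    norm_num
  have hsub : (fun (η : TreeNode m → ℝ) i => round ((r i : ℝ) + prefixNoise m η i)) ⁻¹'
      (nearRanks r w)ᶜ ⊆ ⋃ i, {η | w < |prefixNoise m η i|} := by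
    intro η hη
    simp only [nearRanks, Set.mem_preimage, Set.mem_compl_iff, Set.mem_ofPred_eq, not_forall,
      not_le] at hη
    obtain ⟨i, hi⟩ := hη
    refine Set.mem_iUnion.mpr ⟨i, ?_⟩
    have h1 := abs_sub_round ((r i : ℝ) + prefixNoise m η i)
    have h2 := abs_sub_le (round ((r i : ℝ) + prefixNoise m η i) : ℝ)
      ((r i : ℝ) + prefixNoise m η i) (r i)
    rw [add_sub_cancel_left, abs_sub_comm _ ((r i : ℝ) + prefixNoise m η i)] at h2
    change w < _
    linarith
  refine (measure_mono hsub).trans ((measure_iUnion_fintype_le _ _).trans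
    ((Finset.sum_le_sum fun i _ => measure_lt_abs_prefixNoise_le hs ht0 ht w i).trans
    (le_of_eq ?_)))
  rw [← ENNReal.ofReal_sum_of_nonneg (fun _ _ => by positivity)]
  congr 1
  have hsum : ∀ n : ℕ, ∑ i : Fin n, (2 * ((i.val : ℝ) + 2)) = n * (n + 3) := by
    intro n
    induction n with
    | zero => simp
    | succ n ih =>
      rw [Fin.sum_univ_castSucc]
      simp only [Fin.val_castSucc, Fin.val_last, ih]
      push_cast
      ring
  rw [← Finset.sum_mul, hsum]
  congr 3
  rw [ht_def]
  ring

/-! ### Order statistics and slices of adjacent datasets -/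

lemma SubstituteAdj.symm {X X' : Multiset ℝ} (h : SubstituteAdj X X') : SubstituteAdj X' X := by
  obtain ⟨Y, x, x', h1, h2⟩ := h
  exact ⟨Y, x', x, h2, h1⟩

lemma SubstituteAdj.card_eq {X X' : Multiset ℝ} (h : SubstituteAdj X X') : X.card = X'.card := by
  obtain ⟨Y, x, x', rfl, rfl⟩ := h
  simp

/-- The sequence `g` arises from `f` by inserting one entry at position `p`. -/
def InsertedAt (p : ℤ) (f g : ℤ → ℝ) : Prop :=
  (∀ i < p, g i = f i) ∧ ∀ i, p < i → g i = f (i - 1)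

lemma sort_cons_eq_orderedInsert (x : ℝ) (Y : Multiset ℝ) :
    (x ::ₘ Y).sort (· ≤ ·) = (Y.sort (· ≤ ·)).orderedInsert (· ≤ ·) x := by
  refine List.Perm.eq_of_pairwise' (Multiset.pairwise_sort _ _)
    ((Multiset.pairwise_sort _ _).orderedInsert _ _) ?_
  refine Multiset.coe_eq_coe.mp ?_
  rw [Multiset.sort_eq, Multiset.coe_eq_coe.mpr (List.perm_orderedInsert _ _ _),
    ← Multiset.cons_coe, Multiset.sort_eq]

/-- The default value causes no exception past the end: both lists return `d` there, and the longer
one is read one place further. -/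
lemma exists_getD_orderedInsert (d x : ℝ) (l : List ℝ) :
    ∃ k : ℕ, (∀ i < k, (l.orderedInsert (· ≤ ·) x).getD i d = l.getD i d) ∧
      ∀ i, k ≤ i → (l.orderedInsert (· ≤ ·) x).getD (i + 1) d = l.getD i d := by
  induction l with
  | nil => exact ⟨0, by simp, by simp⟩
  | cons y l ih =>
    by_cases h : x ≤ y
    · exact ⟨0, by simp, by simp [h]⟩
    · obtain ⟨k, h1, h2⟩ := ih
      refine ⟨k + 1, fun i hi => ?_, fun i hi => ?_⟩
      · cases i with
        | zero => simp [h]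
        | succ i =>
          rw [List.orderedInsert_cons, if_neg h, List.getD_cons_succ, List.getD_cons_succ]
          exact h1 i (by omega)
      · cases i with
        | zero => omega
        | succ i =>
          rw [List.orderedInsert_cons, if_neg h, List.getD_cons_succ, List.getD_cons_succ]
          exact h2 i (by omega)

lemma exists_insertedAt_orderStat (b : ℕ) (x : ℝ) (Y : Multiset ℝ) :
    ∃ p : ℤ, InsertedAt p (orderStat b Y) (orderStat b (x ::ₘ Y)) := by
  obtain ⟨k, h1, h2⟩ := exists_getD_orderedInsert b x (Y.sort (· ≤ ·))
  refine ⟨k + 1, fun i hi => ?_, fun i hi => ?_⟩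
  · unfold orderStat
    split_ifs with h0
    · rfl
    · rw [sort_cons_eq_orderedInsert]
      exact h1 _ (by omega)
  · unfold orderStat
    rw [if_neg (by omega), if_neg (by omega), sort_cons_eq_orderedInsert,
      ← h2 ((i - 1).toNat - 1) (by omega)]
    congr 1
    omega

lemma orderStat_mem_Icc {b : ℕ} {X : Multiset ℝ} (hX : X ∈ InDomain b) (i : ℤ) :
    orderStat b X i ∈ Set.Icc (0 : ℝ) b := by
  have hb : (0 : ℝ) ≤ b := Nat.cast_nonneg b
  unfold orderStat
  split_ifs
  · exact ⟨le_rfl, hb⟩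
  · by_cases h : i.toNat - 1 < (X.sort (· ≤ ·)).length
    · rw [List.getD_eq_getElem _ _ h]
      exact hX _ ((Multiset.mem_sort _).mp (List.getElem_mem h))
    · rw [List.getD_eq_default _ _ (not_lt.mp h)]
      exact ⟨hb, le_rfl⟩

lemma slice_mem_inDomain {b : ℕ} {X : Multiset ℝ} (hX : X ∈ InDomain b) (r : ℤ) (h : ℕ) :
    slice b X r h ∈ InDomain b := by
  intro x hx
  obtain ⟨i, -, rfl⟩ := Multiset.mem_map.mp hx
  exact orderStat_mem_Icc hX i

lemma map_Icc_succ_right (f : ℤ → ℝ) {u v : ℤ} (h : u ≤ v + 1) :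
    (Finset.Icc u (v + 1)).val.map f = f (v + 1) ::ₘ (Finset.Icc u v).val.map f := by
  have : Finset.Icc u (v + 1) = (Finset.Icc u v).cons (v + 1) (by simp) := by
    ext i
    simp only [Finset.mem_Icc, Finset.mem_cons]
    omega
  rw [this, Finset.cons_val, Multiset.map_cons]

lemma map_Icc_succ_left (f : ℤ → ℝ) {u v : ℤ} (h : u ≤ v) :
    (Finset.Icc u v).val.map f = f u ::ₘ (Finset.Icc (u + 1) v).val.map f := by
  have : Finset.Icc u v = (Finset.Icc (u + 1) v).cons u (by simp) := by
    ext i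
    simp only [Finset.mem_Icc, Finset.mem_cons]
    omega
  rw [this, Finset.cons_val, Multiset.map_cons]

lemma map_Icc_congr {f g : ℤ → ℝ} {u v : ℤ} (h : ∀ i, u ≤ i → i ≤ v → g i = f i) :
    (Finset.Icc u v).val.map g = (Finset.Icc u v).val.map f := by
  refine Multiset.map_congr rfl fun i hi => ?_
  have := Finset.mem_Icc.mp (Finset.mem_val.mp hi)
  exact h i this.1 this.2

/-- The extra point `c` is the inserted entry if it lies in the window, and otherwise the entry of
`f` next to the window, on the left or on the right. Dropping the last or the first entry of the
longer window then yields the two comparisons of slices needed below. -/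
lemma InsertedAt.map_Icc_succ_right {p : ℤ} {f g : ℤ → ℝ} (H : InsertedAt p f g) {u v : ℤ}
    (h : u ≤ v + 1) :
    ∃ c, (Finset.Icc u (v + 1)).val.map g = c ::ₘ (Finset.Icc u v).val.map f := by
  obtain ⟨v, rfl⟩ : ∃ v', v = v' - 1 := ⟨v + 1, by ring⟩
  rw [sub_add_cancel] at h ⊢
  induction v, h using Int.leInduction with
  | base => exact ⟨g u, by simp⟩
  | succ v hv ih =>
    obtain ⟨c, hc⟩ := ih
    rw [add_sub_cancel_right, DPQuantiles.map_Icc_succ_right g (by omega)]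
    by_cases hp : p < v + 1
    · refine ⟨c, ?_⟩
      have := DPQuantiles.map_Icc_succ_right f (u := u) (v := v - 1) (by omega)
      rw [sub_add_cancel] at this
      rw [hc, H.2 _ hp, add_sub_cancel_right, this, Multiset.cons_swap]
    · exact ⟨g (v + 1), by rw [map_Icc_congr fun i _ hi => H.1 i (by omega)]⟩

lemma substituteAdj_of_cons_eq_cons {A B : Multiset ℝ} {a c : ℝ} (h : a ::ₘ A = c ::ₘ B)
    (hB : B ≠ 0) : SubstituteAdj B A := by
  rcases Multiset.cons_eq_cons.mp h with ⟨-, rfl⟩ | ⟨-, C, rfl, rfl⟩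
  -- Equal multisets still need a point to substitute by itself, hence the nonemptiness.
  · obtain ⟨x, hx⟩ := Multiset.exists_mem_of_ne_zero hB
    obtain ⟨C, hC⟩ := Multiset.exists_cons_of_mem hx
    exact ⟨C, x, x, hC, hC⟩
  · exact ⟨C, a, c, rfl, rfl⟩

lemma slice_ne_zero (b : ℕ) (X : Multiset ℝ) (r : ℤ) (h : ℕ) : slice b X r h ≠ 0 := by
  intro h0
  have := congrArg Multiset.card h0
  simp [slice] at this
  omega

section Cons

variable {b : ℕ} {x : ℝ} {Y : Multiset ℝ} {p r : ℤ} {h : ℕ}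

lemma slice_cons_of_lt (H : InsertedAt p (orderStat b Y) (orderStat b (x ::ₘ Y)))
    (hr : r + h < p) : slice b (x ::ₘ Y) r h = slice b Y r h :=
  map_Icc_congr fun i _ hi => H.1 i (by omega)

lemma slice_cons_of_le (H : InsertedAt p (orderStat b Y) (orderStat b (x ::ₘ Y)))
    (hr : p ≤ r - h) : slice b (x ::ₘ Y) (r + 1) h = slice b Y r h := by
  unfold slice
  have e : Finset.Icc (r + 1 - (h : ℤ)) (r + 1 + h)
      = (Finset.Icc (r - (h : ℤ)) (r + h)).map (addRightEmbedding 1) := by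
    rw [Finset.map_add_right_Icc]
    congr 1 <;> ring
  rw [e, Finset.map_val, Multiset.map_map]
  refine Multiset.map_congr rfl fun i hi => ?_
  have := Finset.mem_Icc.mp (Finset.mem_val.mp hi)
  simp only [Function.comp, addRightEmbedding_apply]
  rw [H.2 _ (by omega), add_sub_cancel_right]

lemma substituteAdj_slice_cons (H : InsertedAt p (orderStat b Y) (orderStat b (x ::ₘ Y))) :
    SubstituteAdj (slice b Y r h) (slice b (x ::ₘ Y) r h) := by
  obtain ⟨c, hc⟩ := H.map_Icc_succ_right (u := r - h) (v := r + h) (by omega)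
  rw [map_Icc_succ_right _ (by omega)] at hc
  exact substituteAdj_of_cons_eq_cons hc (slice_ne_zero b Y r h)

lemma substituteAdj_slice_cons_succ (H : InsertedAt p (orderStat b Y) (orderStat b (x ::ₘ Y))) :
    SubstituteAdj (slice b Y r h) (slice b (x ::ₘ Y) (r + 1) h) := by
  obtain ⟨c, hc⟩ := H.map_Icc_succ_right (u := r - h) (v := r + h) (by omega)
  rw [map_Icc_succ_left _ (by omega), sub_add_eq_add_sub, add_right_comm] at hc
  exact substituteAdj_of_cons_eq_cons hc (slice_ne_zero b Y r h)

end Cons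

/-- The families of slices `S` and `S'` differ in at most one slice, and there by at most the
substitution of one point. -/
def OneSubst {m : ℕ} (S S' : Fin m → Multiset ℝ) : Prop :=
  ∃ e, ∀ j, (j ≠ e → S j = S' j) ∧ SubstituteAdj (S j) (S' j)

lemma OneSubst.symm {m : ℕ} {S S' : Fin m → Multiset ℝ} (h : OneSubst S S') : OneSubst S' S := by
  obtain ⟨e, he⟩ := h
  exact ⟨e, fun j => ⟨fun hj => ((he j).1 hj).symm, (he j).2.symm⟩⟩

/-- If the ranks `ρ` are well separated, then adding a point affects at most one of the slices
around ranks near `ρ`, provided that the ranks behind the new point are shifted by one. -/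
lemma oneSubst_slice_cons {m : ℕ} (hm : 0 < m) {b h : ℕ} {x : ℝ} {Y : Multiset ℝ} {p : ℤ}
    (H : InsertedAt p (orderStat b Y) (orderStat b (x ::ₘ Y))) (hh : 1 ≤ h) {w : ℝ} (hw : 0 ≤ w)
    {ρ : Fin m → ℤ} (hgap : ∀ i j, i < j → (ρ i : ℝ) + 2 * (w + h) < ρ j) {J : ℕ}
    (hJ1 : ∀ j : Fin m, j.val < J → ρ j ≤ p) (hJ2 : ∀ j : Fin m, J ≤ j.val → p - 1 ≤ ρ j)
    {r : Fin m → ℤ} (hr : r ∈ nearRanks ρ w) :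
    OneSubst (fun j => slice b Y (r j) h) (fun j => slice b (x ::ₘ Y) (suffixShift J 1 r j) h) := by
  -- Gaps above `2 (w + h)` allow at most one rank within `w + h` of `p - 1 / 2`. This centre lies
  -- midway between the two thresholds `p - 1` and `p`, so the rounding error `1 / 2` is affordable
  -- on both sides. If no rank is that close, any index serves as `e`.
  obtain ⟨e, he⟩ : ∃ e : Fin m, ∀ j, j ≠ e → w + h < |(ρ j : ℝ) - (p - 1 / 2)| := by
    by_cases hc : ∃ e : Fin m, |(ρ e : ℝ) - (p - 1 / 2)| ≤ w + h
    · obtain ⟨e, he⟩ := hc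
      refine ⟨e, fun j hj => ?_⟩
      by_contra! hj'
      have h1 := abs_le.mp he
      have h2 := abs_le.mp hj'
      rcases lt_or_gt_of_ne hj with hlt | hlt
      · linarith [hgap _ _ hlt]
      · linarith [hgap _ _ hlt]
    · push Not at hc
      exact ⟨⟨0, hm⟩, fun j _ => hc j⟩
  have hh' : (1 : ℝ) ≤ h := by exact_mod_cast hh
  refine ⟨e, fun j => ⟨fun hj => ?_, ?_⟩⟩
  · have h1 := he j hj
    have h2 := abs_le.mp (hr j)
    by_cases hJ : J ≤ j.val
    · have h3 : (p : ℝ) - 1 ≤ ρ j := by exact_mod_cast hJ2 j hJ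
      rcases lt_abs.mp h1 with h4 | h4
      · simp only [suffixShift, if_pos hJ]
        refine (slice_cons_of_le H ?_).symm
        have : (p : ℝ) - 1 < r j - h := by linarith
        have : p - 1 < r j - h := by exact_mod_cast this
        omega
      · linarith
    · have h3 : (ρ j : ℝ) ≤ p := by exact_mod_cast hJ1 j (not_le.mp hJ)
      rcases lt_abs.mp h1 with h4 | h4
      · linarith
      · simp only [suffixShift, if_neg hJ, add_zero]
        refine (slice_cons_of_lt H ?_).symm
        have : (r j : ℝ) + h < p := by linarith
        exact_mod_cast this
  · by_cases hJ : J ≤ j.val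
    · simp only [suffixShift, if_pos hJ]
      exact substituteAdj_slice_cons_succ H
    · simp only [suffixShift, if_neg hJ, add_zero]
      exact substituteAdj_slice_cons H

/-! ### Well separated ranks -/

lemma exists_threshold {m : ℕ} {ρ : Fin m → ℤ} (hρ : Monotone ρ) (p : ℤ) :
    ∃ J : ℕ, ∀ j : Fin m, J ≤ j.val ↔ p ≤ ρ j := by
  by_cases hc : ∃ k, ∃ hk : k < m, p ≤ ρ ⟨k, hk⟩
  · classical
    refine ⟨Nat.find hc, fun j => ⟨fun hj => ?_, fun hj => Nat.find_le ⟨j.isLt, hj⟩⟩⟩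
    obtain ⟨hk, h⟩ := Nat.find_spec hc
    exact h.trans (hρ (Fin.le_def.mpr hj))
  · push Not at hc
    exact ⟨m, fun j => ⟨fun hj => absurd j.isLt (not_lt.mpr hj),
      fun hj => absurd hj (not_le.mpr (hc j.val j.isLt))⟩⟩

lemma gap_of_mem_good {m n : ℕ} {t : ℝ} (ht : 0 ≤ t) {r : Fin m → ℤ} (hr : r ∈ Good m n t)
    {i j : Fin m} (hij : i < j) : (r i : ℝ) + 2 * t ≤ r j := by
  obtain ⟨j, hj⟩ := j
  induction j with
  | zero => exact absurd hij (Nat.not_lt_zero _)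
  | succ j ih =>
    have h1 := hr.2.1 ⟨j, by omega⟩ ⟨j + 1, hj⟩ rfl
    rcases (Nat.lt_succ_iff.mp (Fin.lt_def.mp hij)).lt_or_eq with h2 | h2
    · have := ih (by omega) (Fin.lt_def.mpr h2)
      linarith
    · have : i = ⟨j, by omega⟩ := Fin.ext h2
      rw [this]
      exact h1

lemma monotone_of_gap {m : ℕ} {ρ : Fin m → ℤ} {d : ℝ} (hd : 0 ≤ d)
    (h : ∀ i j, i < j → (ρ i : ℝ) + d ≤ ρ j) : Monotone ρ := by
  intro i j hij
  rcases hij.lt_or_eq with h1 | h1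
  · have : (ρ i : ℝ) ≤ ρ j := by linarith [h i j h1]
    exact_mod_cast this
  · rw [h1]

/-- Ranks near well separated ranks remain good after small shifts. -/
lemma mem_good_of_nearRanks {m n h : ℕ} {w : ℝ} {r r' s : Fin m → ℤ}
    (hr : r ∈ Good m n (w + h + 1)) (hr' : r' ∈ nearRanks r w)
    (h1 : ∀ i, |s i - r' i| ≤ 1) (h2 : ∀ i j, i < j → s i - r' i - 1 ≤ s j - r' j) :
    s ∈ Good m n h := by
  refine ⟨fun i hi => ?_, fun i j hij => ?_, fun i hi => ?_⟩
  · have h3 := hr.1 i hi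
    have h4 := abs_le.mp (hr' i)
    -- The margin `w + h + 1` exceeds the error `w + 1 / 2` by more than `h`; by integrality there
    -- is room for a shift by 1.
    have : (h : ℝ) < r' i := by linarith
    have : (h : ℤ) < r' i := by exact_mod_cast this
    have h5 := abs_le.mp (h1 i)
    have : (h : ℤ) ≤ s i := by omega
    exact_mod_cast this
  · have h3 := hr.2.1 i j hij
    have h4 := abs_le.mp (hr' i)
    have h5 := abs_le.mp (hr' j)
    have h6 : ((s i - r' i - 1 : ℤ) : ℝ) ≤ ((s j - r' j : ℤ) : ℝ) :=
      Int.cast_le.mpr (h2 i j (Fin.lt_def.mpr (by omega)))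
    push_cast at h6
    linarith
  · have h3 := hr.2.2 i hi
    have h4 := abs_le.mp (hr' i)
    have : (r' i : ℝ) < n - h := by linarith
    have : r' i < n - h := by exact_mod_cast this
    have h5 := abs_le.mp (h1 i)
    have : s i ≤ n - h := by omega
    exact_mod_cast this

lemma suffixShift_mem_nearRanks {m : ℕ} {r r' : Fin m → ℤ} {w : ℝ} (h : r' ∈ nearRanks r w)
    (J : ℕ) (a : ℤ) : suffixShift J a r' ∈ nearRanks (suffixShift J a r) w := by
  intro i
  have := h i
  simp only [suffixShift]
  push_cast
  rwa [add_sub_add_right_eq_sub]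

lemma suffixShift_neg_cancel {m : ℕ} (J : ℕ) (r : Fin m → ℤ) :
    suffixShift J 1 (suffixShift J (-1) r) = r := by
  funext i
  simp only [suffixShift]
  split_ifs <;> ring

section Adjacent

variable {m b h : ℕ} {w : ℝ} {r : Fin m → ℤ} {x : ℝ} {Y : Multiset ℝ}

/-- Adding a point. -/
lemma exists_oneSubst_add (hm : 0 < m) (hh : 1 ≤ h) (hw : 0 ≤ w)
    (hgap : ∀ i j, i < j → (r i : ℝ) + 2 * (w + h) < r j) (x : ℝ) (Y : Multiset ℝ) :
    ∃ J, ∀ r' ∈ nearRanks r w, OneSubst (fun j => slice b Y (r' j) h)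
      (fun j => slice b (x ::ₘ Y) (suffixShift J 1 r' j) h) := by
  obtain ⟨p, H⟩ := exists_insertedAt_orderStat b x Y
  obtain ⟨J, hJ⟩ := exists_threshold
    (monotone_of_gap (d := 2 * (w + h)) (by positivity) fun i j hij => (hgap i j hij).le) p
  refine ⟨J, fun r' hr' => oneSubst_slice_cons hm H hh hw hgap (fun j hj => ?_) (fun j hj => ?_) hr'⟩
  · have := (hJ j).not.mp (by omega)
    omega
  · have := (hJ j).mp hj
    omega

/-- After a removal the slices are compared around the shifted ranks, whose gaps may have shrunk by
1; the spare 2 in the hypothesis covers this. -/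
lemma gap_suffixShift_neg (hgap : ∀ i j, i < j → (r i : ℝ) + 2 * (w + h + 1) ≤ r j) (J : ℕ)
    (i j : Fin m) (hij : i < j) :
    (suffixShift J (-1) r i : ℝ) + 2 * (w + h) < suffixShift J (-1) r j := by
  have := hgap i j hij
  simp only [suffixShift]
  split_ifs <;> push_cast <;> linarith

/-- Removing a point. -/
lemma exists_oneSubst_remove (hm : 0 < m) (hh : 1 ≤ h) (hw : 0 ≤ w)
    (hgap : ∀ i j, i < j → (r i : ℝ) + 2 * (w + h + 1) ≤ r j) (x : ℝ) (Y : Multiset ℝ) :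
    ∃ J, ∀ r' ∈ nearRanks r w, OneSubst (fun j => slice b (x ::ₘ Y) (r' j) h)
      (fun j => slice b Y (suffixShift J (-1) r' j) h) := by
  obtain ⟨p, H⟩ := exists_insertedAt_orderStat b x Y
  obtain ⟨J, hJ⟩ := exists_threshold (monotone_of_gap (d := 2 * (w + h + 1)) (by positivity) hgap) p
  refine ⟨J, fun r' hr' => ?_⟩
  have := oneSubst_slice_cons hm H hh hw (ρ := suffixShift J (-1) r) (J := J)
    (gap_suffixShift_neg hgap J) (fun j hj => ?_) (fun j hj => ?_) (suffixShift_mem_nearRanks hr' J (-1))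
  · rw [suffixShift_neg_cancel] at this
    exact this.symm
  · have := (hJ j).not.mp (by omega)
    simp only [suffixShift, if_neg (not_le.mpr hj)]
    omega
  · have := (hJ j).mp hj
    simp only [suffixShift, if_pos hj]
    omega

end Adjacent

/-! ### The release loop -/

lemma measurable_clipRange {m : ℕ} (b : ℕ) (π : Equiv.Perm (Fin m)) (t : Fin m) :
    Measurable (clipRange b π t) := by
  unfold clipRange
  refine Measurable.prodMk ?_ ?_
  · split_ifs
    · exact measurable_pi_apply _
    · exact measurable_const
  · split_ifs
    · exact measurable_pi_apply _
    · exact measurable_const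

section Release

variable {m b : ℕ} {SQ : SingleQuantileAlg m} {π : Equiv.Perm (Fin m)}

lemma measurable_releaseStep (hSQ : ∀ k S t, IsMarkovKernel (SQ k S π t))
    (S : Fin m → Multiset ℝ) (t : Fin m) : Measurable (releaseStep b SQ π S t) := by
  have := hSQ ((S (π t)).card / 2) (S (π t)) t
  have hc := measurable_clipRange b π t
  -- Keeping the old estimates next to the new one exhibits the step as a kernel, which gives
  -- measurability.
  let κ : Kernel (Fin m → ℝ) ℝ := (SQ ((S (π t)).card / 2) (S (π t)) π t).comap
    (fun z => (z, clipRange b π t z)) (measurable_id.prodMk hc)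
  have hu : Measurable fun q : (Fin m → ℝ) × ℝ => Function.update q.1 (π t) q.2 := by
    refine measurable_pi_lambda _ fun i => ?_
    by_cases h : i = π t
    · subst h
      simpa using measurable_snd
    · simp only [Function.update_of_ne h]
      exact (measurable_pi_apply i).comp measurable_fst
  have e : releaseStep b SQ π S t = fun z =>
      ((Kernel.id ×ₖ κ).map fun q => Function.update q.1 (π t) q.2) z := by
    funext z
    rw [Kernel.map_apply _ hu, Kernel.prod_apply, Kernel.id_apply, Measure.dirac_prod,
      Measure.map_map hu measurable_prodMk_left]
    rfl
  rw [e]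
  exact Kernel.measurable _

lemma isProbabilityMeasure_releaseStep (hSQ : ∀ k S t, IsMarkovKernel (SQ k S π t))
    (S : Fin m → Multiset ℝ) (t : Fin m) (z : Fin m → ℝ) :
    IsProbabilityMeasure (releaseStep b SQ π S t z) := by
  have := hSQ ((S (π t)).card / 2) (S (π t)) t
  exact Measure.isProbabilityMeasure_map (measurable_update z).aemeasurable

lemma releaseStep_le {ε : ℝ} (hpriv : ∀ k t u, IsPureDP SubstituteAdj (InDomain b)
      (fun S => SQ k S π t u) ε) {S S' : Fin m → Multiset ℝ} (hS : ∀ j, S j ∈ InDomain b)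
    (hS' : ∀ j, S' j ∈ InDomain b) (t : Fin m) (h : SubstituteAdj (S (π t)) (S' (π t)))
    (z : Fin m → ℝ) :
    releaseStep b SQ π S t z ≤ ENNReal.ofReal (Real.exp ε) • releaseStep b SQ π S' t z := by
  refine Measure.le_iff.mpr fun E hE => ?_
  rw [Measure.smul_apply, releaseStep, releaseStep, Measure.map_apply (measurable_update z) hE,
    Measure.map_apply (measurable_update z) hE, h.card_eq]
  exact hpriv _ t _ _ (hS _) _ (hS' _) h _ (measurable_update z hE)

/-- Adaptive composition: the privacy factors of the past and of the present step multiply. -/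
lemma bind_le_smul_bind {α β : Type*} [MeasurableSpace α] [MeasurableSpace β] {μ μ' : Measure α}
    {κ κ' : α → Measure β} {c d : ℝ≥0∞} (hμ : μ ≤ c • μ') (hκ : ∀ z, κ z ≤ d • κ' z)
    (hm : Measurable κ') : μ.bind κ ≤ (d * c) • μ'.bind κ' := by
  refine Measure.le_iff.mpr fun E hE => ?_
  calc μ.bind κ E ≤ ∫⁻ z, κ z E ∂μ := Measure.bind_apply_le _ hE
    _ ≤ ∫⁻ z, d * κ' z E ∂(c • μ') := lintegral_mono' hμ fun z => hκ z E
    _ = ((d * c) • μ'.bind κ') E := by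
      rw [lintegral_smul_measure, lintegral_const_mul _ (Measure.measurable_measure.mp hm E hE),
        Measure.smul_apply, Measure.bind_apply hE hm.aemeasurable, smul_eq_mul, smul_eq_mul]
      ring

lemma foldl_releaseStep_le_of_notMem (hSQ : ∀ k S t, IsMarkovKernel (SQ k S π t))
    {S S' : Fin m → Multiset ℝ} {e : Fin m} (he : ∀ j, j ≠ e → S j = S' j) {c : ℝ≥0∞}
    (l : List (Fin m)) (hl : ∀ t ∈ l, π t ≠ e) {μ μ' : Measure (Fin m → ℝ)} (hμ : μ ≤ c • μ') :
    l.foldl (fun μ t => μ.bind (releaseStep b SQ π S t)) μ ≤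
      c • l.foldl (fun μ t => μ.bind (releaseStep b SQ π S' t)) μ' := by
  induction l generalizing μ μ' with
  | nil => exact hμ
  | cons t l ih =>
    refine ih (fun s hs => hl s (List.mem_cons_of_mem _ hs)) ?_
    rw [← one_mul c]
    refine bind_le_smul_bind hμ (fun z => ?_) (measurable_releaseStep hSQ S' t)
    rw [one_smul, releaseStep, releaseStep, he _ (hl t List.mem_cons_self)]

/-- Before index `e` is reached both runs use the same kernels. The step at `e` costs `exp ε`, and
since `π` is injective and the list has no duplicates, all later steps again agree and merely carry
the factor along. -/
lemma foldl_releaseStep_le (hSQ : ∀ k S t, IsMarkovKernel (SQ k S π t)) {ε : ℝ} (hε : 0 ≤ ε)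
    (hpriv : ∀ k t u, IsPureDP SubstituteAdj (InDomain b) (fun S => SQ k S π t u) ε)
    {S S' : Fin m → Multiset ℝ} (hS : ∀ j, S j ∈ InDomain b) (hS' : ∀ j, S' j ∈ InDomain b)
    {e : Fin m} (he : ∀ j, (j ≠ e → S j = S' j) ∧ SubstituteAdj (S j) (S' j))
    (l : List (Fin m)) (hl : l.Nodup) {μ μ' : Measure (Fin m → ℝ)} (hμ : μ ≤ μ') :
    l.foldl (fun μ t => μ.bind (releaseStep b SQ π S t)) μ ≤
      ENNReal.ofReal (Real.exp ε) •
        l.foldl (fun μ t => μ.bind (releaseStep b SQ π S' t)) μ' := by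
  have h1 : (1 : ℝ≥0∞) ≤ ENNReal.ofReal (Real.exp ε) := by
    rw [ENNReal.one_le_ofReal]
    exact Real.one_le_exp hε
  induction l generalizing μ μ' with
  | nil =>
    intro E
    rw [List.foldl_nil, List.foldl_nil, Measure.smul_apply, smul_eq_mul]
    exact (hμ E).trans (le_mul_of_one_le_left' h1)
  | cons t l ih =>
    obtain ⟨ht, hl'⟩ := List.nodup_cons.mp hl
    by_cases hte : π t = e
    · refine foldl_releaseStep_le_of_notMem hSQ (fun j hj => (he j).1 hj) l (fun s hs hse => ?_) ?_
      · exact ht (π.injective (hse.trans hte.symm) ▸ hs)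
      · rw [← mul_one (ENNReal.ofReal (Real.exp ε))]
        exact bind_le_smul_bind (by rwa [one_smul])
          (releaseStep_le hpriv hS hS' t (he _).2) (measurable_releaseStep hSQ S' t)
    · refine ih hl' ?_
      have := bind_le_smul_bind (μ := μ) (μ' := μ') (c := 1) (d := 1) (κ := releaseStep b SQ π S t)
        (κ' := releaseStep b SQ π S' t) (by rwa [one_smul]) (fun z => ?_)
        (measurable_releaseStep hSQ S' t)
      · rwa [one_mul, one_smul] at this
      · rw [one_smul, releaseStep, releaseStep, (he _).1 hte]

/-- Privacy of the release loop. -/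
lemma releaseAll_le (hSQ : ∀ k S t, IsMarkovKernel (SQ k S π t)) {ε : ℝ} (hε : 0 ≤ ε)
    (hpriv : ∀ k t u, IsPureDP SubstituteAdj (InDomain b) (fun S => SQ k S π t u) ε)
    {S S' : Fin m → Multiset ℝ} (hS : ∀ j, S j ∈ InDomain b) (hS' : ∀ j, S' j ∈ InDomain b)
    (h : OneSubst S S') :
    releaseAll b SQ π S ≤ ENNReal.ofReal (Real.exp ε) • releaseAll b SQ π S' := by
  obtain ⟨e, he⟩ := h
  exact foldl_releaseStep_le hSQ hε hpriv hS hS' he _ (List.nodup_finRange m) le_rfl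

lemma isProbabilityMeasure_releaseAll (hSQ : ∀ k S t, IsMarkovKernel (SQ k S π t))
    (S : Fin m → Multiset ℝ) : IsProbabilityMeasure (releaseAll b SQ π S) := by
  have key : ∀ (l : List (Fin m)) (μ : Measure (Fin m → ℝ)), IsProbabilityMeasure μ →
      IsProbabilityMeasure (l.foldl (fun μ t => μ.bind (releaseStep b SQ π S t)) μ) := by
    intro l
    induction l with
    | nil => exact fun μ hμ => hμ
    | cons t l ih =>
      refine fun μ hμ => ih _ ⟨?_⟩
      rw [Measure.bind_apply MeasurableSet.univ (measurable_releaseStep hSQ S t).aemeasurable]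
      have := fun z => isProbabilityMeasure_releaseStep (b := b) hSQ S t z
      simp
  exact key _ _ inferInstance

lemma ae_releaseAll_mem (hSQ : ∀ k S t, IsMarkovKernel (SQ k S π t))
    (hrange : ∀ k S t u, ∀ᵐ z ∂(SQ k S π t u), z ∈ Set.Ioo (0 : ℝ) b) (S : Fin m → Multiset ℝ) :
    ∀ᵐ z ∂(releaseAll b SQ π S), ∀ i, z i ∈ Set.Ioo (0 : ℝ) b := by
  have hms : ∀ D : Set (Fin m), MeasurableSet {z : Fin m → ℝ | ∀ i ∈ D, z i ∈ Set.Ioo (0 : ℝ) b} := by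
    intro D
    have : {z : Fin m → ℝ | ∀ i ∈ D, z i ∈ Set.Ioo (0 : ℝ) b} =
        ⋂ i ∈ D, (fun z => z i) ⁻¹' Set.Ioo (0 : ℝ) b := by
      ext z; simp
    rw [this]
    exact MeasurableSet.biInter (Set.to_countable D) fun i _ =>
      measurable_pi_apply i measurableSet_Ioo
  -- The initial vector 0 lies outside the open range, so the invariant tracks the set `D` of
  -- coordinates already released.
  have key : ∀ (l : List (Fin m)) (D : Set (Fin m)) (μ : Measure (Fin m → ℝ)),
      (∀ᵐ z ∂μ, ∀ i ∈ D, z i ∈ Set.Ioo (0 : ℝ) b) →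
      ∀ᵐ z ∂(l.foldl (fun μ t => μ.bind (releaseStep b SQ π S t)) μ),
        ∀ i ∈ D ∪ {i | π.symm i ∈ l}, z i ∈ Set.Ioo (0 : ℝ) b := by
    intro l
    induction l with
    | nil => intro D μ h; simpa using h
    | cons t l ih =>
      intro D μ h
      have hstep : ∀ᵐ z ∂(μ.bind (releaseStep b SQ π S t)),
          ∀ i ∈ D ∪ {π t}, z i ∈ Set.Ioo (0 : ℝ) b := by
        rw [ae_iff, ← Set.compl_ofPred, Measure.bind_apply (hms _).compl
          (measurable_releaseStep hSQ S t).aemeasurable]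
        refine (lintegral_congr_ae ?_).trans lintegral_zero
        filter_upwards [h] with z hz
        rw [releaseStep, Measure.map_apply (measurable_update z) (hms _).compl]
        refine measure_mono_null ?_ (ae_iff.mp (hrange _ (S (π t)) t (z, clipRange b π t z)))
        intro y hy hy'
        refine hy fun i hi => ?_
        by_cases hit : i = π t
        · subst hit
          simpa using hy'
        · rw [Function.update_of_ne hit]
          exact hz i (hi.resolve_right hit)
      filter_upwards [ih _ _ hstep] with z hz i hi
      refine hz i ?_
      rcases hi with hi | hi
      · exact Or.inl (Or.inl hi)
      · rcases List.mem_cons.mp hi with hi | hi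
        · exact Or.inl (Or.inr (by simp [← hi]))
        · exact Or.inr hi
  filter_upwards [key (List.finRange m) ∅ (Measure.dirac 0) (by simp)] with z hz i
  exact hz i (Or.inr (List.mem_finRange _))

end Release

/-! ### The amount of noise -/

/-- From `m = 4` on, `T ≤ log m + 1` and `log m ≥ 2` suffice; `m = 3` rests on `2 ^ 4 ≤ 3 ^ 3`. The
bound fails for `m = 2`, where `T = 2`. -/
lemma treeDepth_le_mul_logb {m : ℕ} (hm : 3 ≤ m) : (treeDepth m : ℝ) ≤ 3 / 2 * Real.logb 2 m := by
  have hm0 : (0 : ℝ) < m := by exact_mod_cast (by omega : 0 < m)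
  rcases hm.eq_or_lt with rfl | h4
  · have h : treeDepth 3 = 2 := by
      unfold treeDepth
      exact le_antisymm ((Nat.clog_le_iff_le_pow (by norm_num)).mpr (by norm_num))
        ((Nat.lt_clog_iff_pow_lt (by norm_num)).mpr (by norm_num))
    have h1 : (4 : ℝ) ≤ 3 * Real.logb 2 (3 : ℕ) := by
      have : Real.logb 2 ((2 : ℝ) ^ 4) ≤ Real.logb 2 ((3 : ℝ) ^ 3) :=
        Real.logb_le_logb_of_le (by norm_num) (by norm_num) (by norm_num)
      rw [Real.logb_pow, Real.logb_pow, Real.logb_self_eq_one (by norm_num)] at this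
      push_cast at this ⊢
      linarith
    rw [h]
    push_cast at h1 ⊢
    linarith
  · have h1 : (2 : ℝ) ≤ Real.logb 2 m := by
      rw [Real.le_logb_iff_rpow_le (by norm_num) hm0]
      norm_num
      exact_mod_cast h4
    have h2 : (treeDepth m : ℝ) - 1 ≤ Real.logb 2 m := by
      have h3 : 2 ^ (treeDepth m).pred < m + 1 := Nat.pow_pred_clog_lt_self (by norm_num) (by omega)
      have h5 : (2 : ℝ) ^ (treeDepth m).pred ≤ m := by exact_mod_cast Nat.lt_succ_iff.mp h3
      have h6 := pos_treeDepth (m := m) (by omega)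
      have h7 : ((treeDepth m).pred : ℝ) = treeDepth m - 1 := by
        rw [Nat.pred_eq_sub_one, Nat.cast_pred h6]
      rw [← h7, Real.le_logb_iff_rpow_le (by norm_num) hm0, Real.rpow_natCast]
      exact h5
    linarith

lemma treeDepth_two : treeDepth 2 = 2 :=
  le_antisymm ((Nat.clog_le_iff_le_pow (by norm_num)).mpr (by norm_num))
    ((Nat.lt_clog_iff_pow_lt (by norm_num)).mpr (by norm_num))

/-- Either the required privacy is so weak that it is provided by the uniform outputs alone, or `w`
is nonnegative and large enough for the accuracy of continual counting. -/
lemma trivial_or_accurate {m b : ℕ} (hm : 2 ≤ m) (hb : 2 ≤ b) {ε₁ δ γ w K : ℝ} (hε₁ : 0 < ε₁)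
    (hδ : 0 < δ) (hγ0 : 0 < γ) (hγ1 : γ ≤ 1)
    (hw : 3 * Real.logb 2 m / ε₁ *
      (m * Real.logb 2 b + Real.logb 2 (2 * m / (γ * (Real.exp δ - 1)))) ≤ w)
    (hK : 2 * δ ≤ K) :
    1 ≤ Real.exp K * γ * ((2 * b : ℝ) ^ m)⁻¹ ∨
      (0 ≤ w ∧ m * (m + 3) * Real.exp (-(w * ε₁ / (Real.sqrt 2 * treeDepth m))) ≤
        (Real.exp K - 1) * γ * ((2 * b : ℝ) ^ m)⁻¹) := by
  have hm2 : (2 : ℝ) ≤ m := by exact_mod_cast hm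
  have hb2 : (2 : ℝ) ≤ b := by exact_mod_cast hb
  have hm0 : (0 : ℝ) < m := by linarith
  have hb0 : (0 : ℝ) < b := by linarith
  have hT : (0 : ℝ) < treeDepth m := by exact_mod_cast pos_treeDepth hm
  obtain ⟨q, hq⟩ : ∃ q, q = Real.exp δ - 1 := ⟨_, rfl⟩
  have hq0 : 0 < q := by
    have := Real.add_one_lt_exp hδ.ne'
    linarith
  have hKq : (q + 1) ^ 2 ≤ Real.exp K := by
    rw [hq, sub_add_cancel, ← Real.exp_nat_mul]
    exact Real.exp_le_exp.mpr (by push_cast; exact hK)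
  rw [← hq] at hw
  -- `A` is the number whose binary logarithm is the bracket in `hw`.
  obtain ⟨A, hA⟩ : ∃ A, A = 2 * m * (b : ℝ) ^ m / (γ * q) := ⟨_, rfl⟩
  have hA0 : 0 < A := by rw [hA]; positivity
  have hlogA : m * Real.logb 2 b + Real.logb 2 (2 * m / (γ * q)) = Real.logb 2 A := by
    rw [← Real.logb_pow, ← Real.logb_mul (by positivity) (by positivity), hA]
    congr 1
    ring
  rw [hlogA] at hw
  obtain ⟨u, hu⟩ : ∃ u, u = ((2 * b : ℝ) ^ m)⁻¹ := ⟨_, rfl⟩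
  have hu0 : 0 < u := by rw [hu]; positivity
  rw [← hu]
  have h2m : (0 : ℝ) < 2 ^ m := by positivity
  have hγuq : γ * u * q = 2 * m / A / 2 ^ m := by
    rw [hu, hA, mul_pow]
    field_simp
  -- The grid mass `(2 b)⁻ᵐ` is smaller by `2 ^ m` than the `b⁻ᵐ` built into `A`. A second factor
  -- `q`, available because `2 δ ≤ K`, recovers this loss through `b ≥ 2` and `γ ≤ 1`.
  have hq1 : 2 * m / A * 2 ^ m ≤ q := by
    have e : 2 * m / A * 2 ^ m = γ * q * (2 ^ m / (b : ℝ) ^ m) := by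
      rw [hA]
      field_simp
    have h1 : (2 : ℝ) ^ m / (b : ℝ) ^ m ≤ 1 := by
      rw [div_le_one (by positivity)]
      exact pow_le_pow_left₀ (by norm_num) hb2 m
    rw [e]
    calc γ * q * (2 ^ m / (b : ℝ) ^ m) ≤ 1 * q * 1 := by gcongr
      _ = q := by ring
  have hy0 : 0 < 2 * m / A := by positivity
  by_cases hAm : A ≤ 2 * m
  · left
    have h1 : 1 ≤ 2 * m / A := (one_le_div hA0).mpr hAm
    calc (1 : ℝ) ≤ (2 * m / A) * (2 * m / A) := by nlinarith
      _ = 2 * m / A / 2 ^ m * (2 * m / A * 2 ^ m) := by field_simp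
      _ ≤ 2 * m / A / 2 ^ m * q := by gcongr
      _ = q ^ 2 * γ * u := by rw [← hγuq]; ring
      _ ≤ Real.exp K * γ * u := by
        gcongr
        nlinarith
  right
  have hlA : 0 < Real.log A := Real.log_pos (by linarith)
  have hl2 : 0 < Real.log 2 := Real.log_pos (by norm_num)
  have hlogbA : Real.logb 2 A = Real.log A / Real.log 2 := rfl
  have hlogbA0 : 0 < Real.logb 2 A := div_pos hlA hl2
  have hlogm0 : 0 < Real.logb 2 m := Real.logb_pos (by norm_num) (by linarith)
  have hs0 : 0 < Real.sqrt 2 := by positivity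
  have hs2 : Real.sqrt 2 * Real.sqrt 2 = 2 := Real.mul_self_sqrt (by norm_num)
  -- Passing from base 2 to base `e` gains enough to cancel the `√2` of the Chernoff exponent.
  have hsl : Real.sqrt 2 * Real.log 2 ≤ 1 := by
    have h1 := Real.log_two_lt_d9
    have h2 : Real.sqrt 2 ≤ 1.4143 := by
      rw [Real.sqrt_le_left (by norm_num)]
      norm_num
    nlinarith
  have hAle : Real.log A ≤ Real.logb 2 A / Real.sqrt 2 := by
    rw [hlogbA, div_div, le_div_iff₀ (by positivity)]
    nlinarith
  have hwε : 3 * Real.logb 2 m * Real.logb 2 A ≤ w * ε₁ := by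
    have : 3 * Real.logb 2 m / ε₁ * Real.logb 2 A * ε₁ ≤ w * ε₁ := by gcongr
    calc _ = 3 * Real.logb 2 m / ε₁ * Real.logb 2 A * ε₁ := by field_simp
      _ ≤ _ := this
  refine ⟨le_trans (by positivity) hw, ?_⟩
  -- Here `exp K - 1 ≥ (q + 1)² - 1 = q (q + 2)`.
  have htarget : 2 * m / A / 2 ^ m * (2 * m / A * 2 ^ m + 2) ≤ (Real.exp K - 1) * γ * u := by
    calc _ ≤ 2 * m / A / 2 ^ m * (q + 2) := by gcongr
      _ = ((q + 1) ^ 2 - 1) * γ * u := by rw [← hγuq]; ring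
      _ ≤ _ := by gcongr
  refine le_trans ?_ htarget
  have hdiv : 3 * Real.logb 2 m / treeDepth m * Real.log A ≤
      w * ε₁ / (Real.sqrt 2 * treeDepth m) := by
    calc _ ≤ 3 * Real.logb 2 m / treeDepth m * (Real.logb 2 A / Real.sqrt 2) := by gcongr
      _ = 3 * Real.logb 2 m * Real.logb 2 A / (Real.sqrt 2 * treeDepth m) := by field_simp
      _ ≤ _ := by gcongr
  rcases hm.eq_or_lt with rfl | hm3
  -- For `m = 2` the exponent yields only `A ^ (-3/2)`, so the summand 2 in `htarget` is needed.
  -- With `a = A ^ (-1/2)` the claim reduces to `16 a² - 10 a + 2 ≥ 0`, whose discriminant is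
  -- negative.
  · have h1 : Real.exp (-(w * ε₁ / (Real.sqrt 2 * treeDepth 2))) ≤
        Real.exp (-(Real.log A / 2)) ^ 3 := by
      rw [← Real.exp_nat_mul]
      refine Real.exp_le_exp.mpr ?_
      rw [treeDepth_two] at hdiv ⊢
      push_cast at hdiv ⊢
      rw [Real.logb_self_eq_one (by norm_num)] at hdiv
      linarith
    have h2 : 1 / A = Real.exp (-(Real.log A / 2)) ^ 2 := by
      rw [← Real.exp_nat_mul]
      push_cast
      rw [show 2 * -(Real.log A / 2) = -Real.log A by ring, Real.exp_neg, Real.exp_log hA0, one_div]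
    set a := Real.exp (-(Real.log A / 2))
    have ha0 : 0 < a := Real.exp_pos _
    have h3 : 2 * ((2 : ℕ) : ℝ) / A = 4 * a ^ 2 := by
      rw [← h2]
      push_cast
      ring
    rw [h3]
    have h4 : 10 * a ^ 3 ≤ 16 * a ^ 4 + 2 * a ^ 2 := by
      have h5 : 16 * a ^ 4 + 2 * a ^ 2 - 10 * a ^ 3
          = a ^ 2 * ((4 * a - 5 / 4) ^ 2 + 7 / 16) := by ring
      have h6 : 0 ≤ a ^ 2 * ((4 * a - 5 / 4) ^ 2 + 7 / 16) := by positivity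
      linarith
    calc _ ≤ ((2 : ℕ) : ℝ) * ((2 : ℕ) + 3) * a ^ 3 := mul_le_mul_of_nonneg_left h1 (by positivity)
      _ = 10 * a ^ 3 := by norm_num
      _ ≤ 16 * a ^ 4 + 2 * a ^ 2 := h4
      _ = _ := by ring
  · have h1 : Real.exp (-(w * ε₁ / (Real.sqrt 2 * treeDepth m))) ≤ (1 / A) ^ 2 := by
      have e : (1 / A) ^ 2 = Real.exp (-(2 * Real.log A)) := by
        rw [Real.exp_neg, show 2 * Real.log A = ((2 : ℕ) : ℝ) * Real.log A by norm_num,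
          Real.exp_nat_mul, Real.exp_log hA0]
        simp
      rw [e]
      refine Real.exp_le_exp.mpr (neg_le_neg ?_)
      refine le_trans ?_ hdiv
      have h2 : 2 ≤ 3 * Real.logb 2 m / treeDepth m := by
        rw [le_div_iff₀ hT]
        linarith [treeDepth_le_mul_logb hm3]
      gcongr
    calc m * (m + 3) * Real.exp (-(w * ε₁ / (Real.sqrt 2 * treeDepth m)))
        ≤ m * (m + 3) * (1 / A) ^ 2 := by gcongr
      -- The bound `m + 3 ≤ 2 m` needs `m ≥ 3`.
      _ ≤ (2 * m) * (2 * m) * (1 / A) ^ 2 := by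
        have : (3 : ℝ) ≤ m := by exact_mod_cast hm3
        gcongr <;> linarith only [this]
      _ = 2 * m / A / 2 ^ m * (2 * m / A * 2 ^ m) := by field_simp
      _ ≤ _ := by gcongr; exact le_add_of_nonneg_right zero_le_two

/-! ### The output laws -/

lemma measurable_roundAll (m : ℕ) : Measurable fun (z : Fin m → ℝ) i => round (z i) :=
  measurable_pi_lambda _ fun i => by
    simp only [round_eq]
    exact Int.measurable_floor.comp (by fun_prop)

/-- The possible values of rounded estimates. -/
def outputGrid (m b : ℕ) : Set (Fin m → ℤ) := {g | ∀ i, 0 ≤ g i ∧ g i ≤ b}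

lemma roundAll_mem_outputGrid {m b : ℕ} {z : Fin m → ℝ} (hz : ∀ i, z i ∈ Set.Ioo (0 : ℝ) b) :
    (fun i => round (z i)) ∈ outputGrid m b := by
  intro i
  obtain ⟨h1, h2⟩ := hz i
  simp only [round_eq]
  constructor
  · exact Int.floor_nonneg.mpr (by linarith)
  · rw [← Int.lt_add_one_iff, Int.floor_lt]
    push_cast
    linarith

lemma isProbabilityMeasure_cond_Ioo {b : ℕ} (hb : 0 < b) :
    IsProbabilityMeasure (cond (volume : Measure ℝ) (Set.Ioo (0 : ℝ) b)) :=
  cond_isProbabilityMeasure_of_finite (by simp [hb.ne']) (by simp)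

lemma isProbabilityMeasure_uniformOutput (m : ℕ) {b : ℕ} (hb : 0 < b) :
    IsProbabilityMeasure (uniformOutput m b) := by
  have := isProbabilityMeasure_cond_Ioo hb
  unfold uniformOutput
  infer_instance

lemma ae_uniformOutput_mem (m : ℕ) {b : ℕ} (hb : 0 < b) :
    ∀ᵐ z ∂(uniformOutput m b), ∀ i, z i ∈ Set.Ioo (0 : ℝ) b := by
  have := isProbabilityMeasure_cond_Ioo hb
  rw [ae_all_iff]
  intro i
  exact (Measure.tendsto_eval_ae_ae (i := i)).eventually (ae_cond_mem measurableSet_Ioo)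

/-- Every possible value of the rounded estimates has probability at least `(2 b)⁻ᵐ` under the
uniform law. -/
lemma le_uniformOutput_round {m b : ℕ} (hb : 0 < b) {g : Fin m → ℤ} (hg : g ∈ outputGrid m b) :
    ENNReal.ofReal ((2 * b : ℝ) ^ m)⁻¹ ≤
      uniformOutput m b ((fun z i => round (z i)) ⁻¹' {g}) := by
  have := isProbabilityMeasure_cond_Ioo hb
  have hb0 : (1 : ℝ) ≤ b := by exact_mod_cast hb
  -- An interval of length `1 / 2` rounding to `g i`: to the right of `g i`, or, when `g i = b`, to
  -- the left of `b`.
  let c : Fin m → ℝ := fun i => min (g i) (b - 1 / 2)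
  have hsub : Set.pi Set.univ (fun i => Set.Ioo (c i) (c i + 1 / 2)) ⊆
      (fun (z : Fin m → ℝ) i => round (z i)) ⁻¹' {g} := by
    intro z hz
    rw [Set.mem_preimage, Set.mem_singleton_iff]
    funext i
    have h1 := hz i (Set.mem_univ i)
    have h2 : (g i : ℝ) ≤ b := by exact_mod_cast (hg i).2
    have h3 : c i ≤ g i := min_le_left _ _
    have h4 : (g i : ℝ) - 1 / 2 ≤ c i := le_min (by linarith) (by linarith)
    have h5 := h1.1
    have h6 := h1.2
    rw [round_eq, Int.floor_eq_iff]
    constructor <;> linarith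
  refine le_trans (le_of_eq ?_) (measure_mono hsub)
  rw [uniformOutput, Measure.pi_pi]
  have : ∀ i, cond volume (Set.Ioo (0 : ℝ) b) (Set.Ioo (c i) (c i + 1 / 2)) =
      ENNReal.ofReal (2 * b : ℝ)⁻¹ := by
    intro i
    have h1 : (0 : ℝ) ≤ g i := by exact_mod_cast (hg i).1
    have h2 : 0 ≤ c i := le_min h1 (by linarith)
    have h3 : c i ≤ b - 1 / 2 := min_le_right _ _
    rw [cond_apply measurableSet_Ioo, Set.inter_eq_self_of_subset_right
      (Set.Ioo_subset_Ioo h2 (by linarith)), Real.volume_Ioo, Real.volume_Ioo,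
      ← ENNReal.ofReal_inv_of_pos (by linarith), ← ENNReal.ofReal_mul (by simp)]
    congr 1
    have : (b : ℝ) ≠ 0 := by linarith
    field_simp
    ring
  simp only [this, Finset.prod_const, Finset.card_univ, Fintype.card_fin]
  rw [← ENNReal.ofReal_pow (by positivity), inv_pow]

section Laws

variable {m b : ℕ} {r : Fin m → ℤ} {ε₁ ℓ γ : ℝ} {SQ : SingleQuantileAlg m} {π : Equiv.Perm (Fin m)}

open Classical in
lemma roundedSliceQuantiles_apply (X : Multiset ℝ) (E : Set (Fin m → ℤ)) :
    roundedSliceQuantiles b r ε₁ ℓ γ SQ π X E =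
      ENNReal.ofReal γ * uniformOutput m b ((fun z i => round (z i)) ⁻¹' E) +
      ENNReal.ofReal (1 - γ) * ∫⁻ r', (if r' ∈ Good m X.card (⌈ℓ / 2⌉₊ : ℝ)
        then releaseAll b SQ π fun j => slice b X (r' j) ⌈ℓ / 2⌉₊
        else uniformOutput m b) ((fun z i => round (z i)) ⁻¹' E) ∂(continualCounting m ε₁ r) := by
  have hE : MeasurableSet E := (Set.to_countable E).measurableSet
  rw [roundedSliceQuantiles, Measure.map_apply (measurable_roundAll m) hE, sliceQuantiles,
    Measure.add_apply, Measure.smul_apply, Measure.smul_apply,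
    Measure.bind_apply (measurable_roundAll m hE) (measurable_of_countable _).aemeasurable,
    smul_eq_mul, smul_eq_mul]

lemma le_roundedSliceQuantiles (X : Multiset ℝ) (E : Set (Fin m → ℤ)) :
    ENNReal.ofReal γ * uniformOutput m b ((fun z i => round (z i)) ⁻¹' E) ≤
      roundedSliceQuantiles b r ε₁ ℓ γ SQ π X E := by
  rw [roundedSliceQuantiles_apply]
  exact le_self_add

lemma roundedSliceQuantiles_eq_zero (hb : 0 < b) (hSQ : ∀ k S t, IsMarkovKernel (SQ k S π t))
    (hrange : ∀ k S t u, ∀ᵐ z ∂(SQ k S π t u), z ∈ Set.Ioo (0 : ℝ) b) (X : Multiset ℝ)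
    {E : Set (Fin m → ℤ)} (hE : Disjoint E (outputGrid m b)) :
    roundedSliceQuantiles b r ε₁ ℓ γ SQ π X E = 0 := by
  have key : ∀ μ : Measure (Fin m → ℝ), (∀ᵐ z ∂μ, ∀ i, z i ∈ Set.Ioo (0 : ℝ) b) →
      μ ((fun z i => round (z i)) ⁻¹' E) = 0 := fun μ hμ =>
    measure_mono_null (fun z hz hz' => Set.disjoint_left.mp hE hz (roundAll_mem_outputGrid hz')) hμ
  rw [roundedSliceQuantiles_apply, key _ (ae_uniformOutput_mem m hb), mul_zero, zero_add]
  refine mul_eq_zero_of_right _ (Eq.trans (lintegral_congr fun r' => ?_) lintegral_zero)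
  split_ifs
  · exact key _ (ae_releaseAll_mem hSQ hrange _)
  · exact key _ (ae_uniformOutput_mem m hb)

lemma roundedSliceQuantiles_le_one (hm : 2 ≤ m) (hb : 0 < b) (hε₁ : 0 < ε₁) (hγ0 : 0 ≤ γ)
    (hγ1 : γ ≤ 1) (hSQ : ∀ k S t, IsMarkovKernel (SQ k S π t)) (X : Multiset ℝ)
    (E : Set (Fin m → ℤ)) : roundedSliceQuantiles b r ε₁ ℓ γ SQ π X E ≤ 1 := by
  have := isProbabilityMeasure_continualCounting hm hε₁ r
  have := isProbabilityMeasure_uniformOutput m hb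
  have := fun S => isProbabilityMeasure_releaseAll (b := b) hSQ S
  rw [roundedSliceQuantiles_apply]
  calc _ ≤ ENNReal.ofReal γ * 1 + ENNReal.ofReal (1 - γ) *
        ∫⁻ _, 1 ∂(continualCounting m ε₁ r) := by
        gcongr with r'
        · exact prob_le_one
        · split_ifs <;> exact prob_le_one
    _ = 1 := by
      rw [lintegral_one, measure_univ, mul_one, mul_one, ← ENNReal.ofReal_add hγ0 (by linarith)]
      simp

lemma le_uniformOutput_of_not_disjoint (hb : 0 < b) {E : Set (Fin m → ℤ)}
    (hE : ¬Disjoint E (outputGrid m b)) :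
    ENNReal.ofReal ((2 * b : ℝ) ^ m)⁻¹ ≤ uniformOutput m b ((fun z i => round (z i)) ⁻¹' E) := by
  obtain ⟨g, hgE, hg⟩ := Set.not_disjoint_iff.mp hE
  exact (le_uniformOutput_round hb hg).trans
    (measure_mono (Set.preimage_mono (Set.singleton_subset_iff.mpr hgE)))

/-- Privacy from the uniform outputs alone. -/
lemma roundedSliceQuantiles_le_of_one_le (hm : 2 ≤ m) (hb : 0 < b) (hε₁ : 0 < ε₁) (hγ0 : 0 ≤ γ)
    (hγ1 : γ ≤ 1) (hSQ : ∀ k S t, IsMarkovKernel (SQ k S π t))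
    (hrange : ∀ k S t u, ∀ᵐ z ∂(SQ k S π t u), z ∈ Set.Ioo (0 : ℝ) b) {K : ℝ}
    (hK : 1 ≤ Real.exp K * γ * ((2 * b : ℝ) ^ m)⁻¹) (X X' : Multiset ℝ) (E : Set (Fin m → ℤ)) :
    roundedSliceQuantiles b r ε₁ ℓ γ SQ π X E ≤
      ENNReal.ofReal (Real.exp K) * roundedSliceQuantiles b r ε₁ ℓ γ SQ π X' E := by
  by_cases hE : Disjoint E (outputGrid m b)
  · rw [roundedSliceQuantiles_eq_zero hb hSQ hrange X hE]
    exact zero_le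
  calc _ ≤ 1 := roundedSliceQuantiles_le_one hm hb hε₁ hγ0 hγ1 hSQ X E
    _ ≤ ENNReal.ofReal (Real.exp K * γ * ((2 * b : ℝ) ^ m)⁻¹) := ENNReal.one_le_ofReal.mpr hK
    _ = ENNReal.ofReal (Real.exp K) * (ENNReal.ofReal γ * ENNReal.ofReal ((2 * b : ℝ) ^ m)⁻¹) := by
      rw [mul_assoc, ENNReal.ofReal_mul (Real.exp_pos K).le, ENNReal.ofReal_mul hγ0]
    _ ≤ _ := by
      gcongr
      exact le_trans (by gcongr; exact le_uniformOutput_of_not_disjoint hb hE)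
        (le_roundedSliceQuantiles X' E)

/-- Privacy from a coupling `φ` of the noisy ranks on the likely event `N`. -/
lemma roundedSliceQuantiles_le_of_coupling (hb : 0 < b) (hγ0 : 0 ≤ γ)
    (hSQ : ∀ k S t, IsMarkovKernel (SQ k S π t))
    (hrange : ∀ k S t u, ∀ᵐ z ∂(SQ k S π t u), z ∈ Set.Ioo (0 : ℝ) b) {K α β : ℝ} (hα : 0 ≤ α)
    (hβ : 0 ≤ β) (hK : α + β ≤ K) {X X' : Multiset ℝ} {φ : (Fin m → ℤ) → Fin m → ℤ}
    {N : Set (Fin m → ℤ)}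
    (hN : ∀ r' ∈ N, r' ∈ Good m X.card (⌈ℓ / 2⌉₊ : ℝ))
    (hN' : ∀ r' ∈ N, φ r' ∈ Good m X'.card (⌈ℓ / 2⌉₊ : ℝ))
    (hrel : ∀ r' ∈ N, (releaseAll b SQ π fun j => slice b X (r' j) ⌈ℓ / 2⌉₊) ≤
      ENNReal.ofReal (Real.exp α) •
        releaseAll b SQ π fun j => slice b X' (φ r' j) ⌈ℓ / 2⌉₊)
    (hφ : (continualCounting m ε₁ r).map φ ≤
      ENNReal.ofReal (Real.exp β) • continualCounting m ε₁ r)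
    (hNc : continualCounting m ε₁ r Nᶜ ≤
      ENNReal.ofReal ((Real.exp K - 1) * γ * ((2 * b : ℝ) ^ m)⁻¹)) (E : Set (Fin m → ℤ)) :
    roundedSliceQuantiles b r ε₁ ℓ γ SQ π X E ≤
      ENNReal.ofReal (Real.exp K) * roundedSliceQuantiles b r ε₁ ℓ γ SQ π X' E := by
  by_cases hE : Disjoint E (outputGrid m b)
  · rw [roundedSliceQuantiles_eq_zero hb hSQ hrange X hE]
    exact zero_le
  have hQ := le_uniformOutput_of_not_disjoint hb hE
  have := isProbabilityMeasure_uniformOutput m hb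
  have := fun S => isProbabilityMeasure_releaseAll (b := b) hSQ S
  classical
  rw [roundedSliceQuantiles_apply, roundedSliceQuantiles_apply]
  set F := (fun (z : Fin m → ℝ) i => round (z i)) ⁻¹' E
  set P := continualCounting m ε₁ r
  set Q := uniformOutput m b F
  set G : (Fin m → ℤ) → ℝ≥0∞ := fun r' => (if r' ∈ Good m X.card (⌈ℓ / 2⌉₊ : ℝ)
        then releaseAll b SQ π fun j => slice b X (r' j) ⌈ℓ / 2⌉₊
        else uniformOutput m b) F with hG
  set G' : (Fin m → ℤ) → ℝ≥0∞ := fun r' => (if r' ∈ Good m X'.card (⌈ℓ / 2⌉₊ : ℝ)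
        then releaseAll b SQ π fun j => slice b X' (r' j) ⌈ℓ / 2⌉₊
        else uniformOutput m b) F with hG'
  have hNm : MeasurableSet N := (Set.to_countable N).measurableSet
  have hGle : ∀ r', G r' ≤ 1 := by
    intro r'
    simp only [hG]
    split_ifs <;> exact prob_le_one
  have hK0 : 0 ≤ Real.exp K - 1 := by
    have := Real.one_le_exp (show 0 ≤ K by linarith)
    linarith
  -- On `N` the coupling applies; off `N` the failure probability is charged to the surplus `exp K -
  -- 1` of the uniform branch.
  have h1 : ∫⁻ r', G r' ∂P ≤ ENNReal.ofReal (Real.exp K) * ∫⁻ r', G' r' ∂P +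
      ENNReal.ofReal (Real.exp K - 1) * (ENNReal.ofReal γ * Q) := by
    rw [← lintegral_add_compl _ hNm]
    refine add_le_add ?_ ?_
    · calc ∫⁻ r' in N, G r' ∂P
          ≤ ∫⁻ r' in N, ENNReal.ofReal (Real.exp α) * G' (φ r') ∂P := by
            refine setLIntegral_mono' hNm fun r' hr' => ?_
            simp only [hG, hG']
            rw [if_pos (hN r' hr'), if_pos (hN' r' hr')]
            exact hrel r' hr' F
        _ ≤ ∫⁻ r', ENNReal.ofReal (Real.exp α) * G' (φ r') ∂P := setLIntegral_le_lintegral _ _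
        _ = ENNReal.ofReal (Real.exp α) * ∫⁻ r', G' r' ∂(P.map φ) := by
            rw [lintegral_const_mul _ (measurable_of_countable _),
              lintegral_map (measurable_of_countable _) (measurable_of_countable _)]
        _ ≤ ENNReal.ofReal (Real.exp α) *
              ∫⁻ r', G' r' ∂(ENNReal.ofReal (Real.exp β) • P) := by
            gcongr
        _ = ENNReal.ofReal (Real.exp (α + β)) * ∫⁻ r', G' r' ∂P := by
            rw [lintegral_smul_measure, smul_eq_mul, ← mul_assoc,
              ← ENNReal.ofReal_mul (Real.exp_pos α).le, Real.exp_add]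
        _ ≤ _ := by gcongr
    · calc ∫⁻ r' in Nᶜ, G r' ∂P ≤ ∫⁻ _ in Nᶜ, 1 ∂P := lintegral_mono fun r' => hGle r'
        _ = P Nᶜ := by simp
        _ ≤ ENNReal.ofReal ((Real.exp K - 1) * γ * ((2 * b : ℝ) ^ m)⁻¹) := hNc
        _ = ENNReal.ofReal (Real.exp K - 1) *
            (ENNReal.ofReal γ * ENNReal.ofReal ((2 * b : ℝ) ^ m)⁻¹) := by
            rw [mul_assoc, ENNReal.ofReal_mul hK0, ENNReal.ofReal_mul hγ0]
        _ ≤ _ := by gcongr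
  have h2 : ENNReal.ofReal (1 - γ) ≤ 1 := by
    rw [← ENNReal.ofReal_one]
    exact ENNReal.ofReal_le_ofReal (by linarith)
  calc ENNReal.ofReal γ * Q + ENNReal.ofReal (1 - γ) * ∫⁻ r', G r' ∂P
      ≤ ENNReal.ofReal γ * Q + (ENNReal.ofReal (1 - γ) *
          (ENNReal.ofReal (Real.exp K) * ∫⁻ r', G' r' ∂P) +
          1 * (ENNReal.ofReal (Real.exp K - 1) * (ENNReal.ofReal γ * Q))) := by
        refine add_le_add le_rfl ((mul_le_mul_right h1 _).trans ?_)
        rw [mul_add]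
        gcongr
    _ = (1 + ENNReal.ofReal (Real.exp K - 1)) * (ENNReal.ofReal γ * Q) +
          ENNReal.ofReal (Real.exp K) * (ENNReal.ofReal (1 - γ) * ∫⁻ r', G' r' ∂P) := by ring
    _ = _ := by
      rw [← ENNReal.ofReal_one, ← ENNReal.ofReal_add zero_le_one hK0, add_sub_cancel, mul_add]

end Laws

end DPQuantiles

end

open DPQuantiles in
theorem corollary1 (m b : ℕ) (hm : 2 ≤ m) (hb : 2 ≤ b)
    (ε₁ ε₂ : ℝ) (hε₁ : 0 < ε₁) (hε₂ : 0 < ε₂)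
    (ℓ : ℝ) (hℓ : 1 ≤ ℓ) (γ : ℝ) (hγ0 : 0 < γ) (hγ1 : γ ≤ 1)
    (r : Fin m → ℤ) (π : Equiv.Perm (Fin m))
    (SQ : DPQuantiles.SingleQuantileAlg m)
    (hSQ_markov : ∀ k S t, ProbabilityTheory.IsMarkovKernel (SQ k S π t))
    (hSQ_range : ∀ k S t u, ∀ᵐ z ∂(SQ k S π t u), z ∈ Set.Ioo (0 : ℝ) b)
    (hSQ_private : ∀ k t u, DPQuantiles.IsPureDP DPQuantiles.SubstituteAdj
      (DPQuantiles.InDomain b) (fun S => SQ k S π t u) ε₂) :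
    DPQuantiles.IsPureDP DPQuantiles.AddRemoveAdj
      (DPQuantiles.RequiredInput b r (DPQuantiles.wAddRemove m b ε₁ ε₂ γ) ℓ)
      (DPQuantiles.roundedSliceQuantiles b r ε₁ ℓ γ SQ π) (ε₁ + 2 * ε₂) ∧
    DPQuantiles.IsPureDP DPQuantiles.SubstituteAdj
      (DPQuantiles.RequiredInput b r (DPQuantiles.wSubstitute m b ε₁ ε₂ γ) ℓ)
      (DPQuantiles.roundedSliceQuantiles b r ε₁ ℓ γ SQ π) (2 * ε₁ + 3 * ε₂) := by
  have hm0 : 0 < m := by omega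
  have hb0 : 0 < b := by omega
  have hh : 1 ≤ ⌈ℓ / 2⌉₊ := Nat.one_le_iff_ne_zero.mpr (Nat.ceil_pos.mpr (by linarith)).ne'
  constructor
  · rintro X ⟨hX, hrX⟩ X' ⟨hX', hrX'⟩ hadj E -
    rcases trivial_or_accurate (K := ε₁ + 2 * ε₂) hm hb hε₁ hε₂ hγ0 hγ1
      (le_refl (wAddRemove m b ε₁ ε₂ γ)) (by linarith) with hK | ⟨hw, hK⟩
    · exact roundedSliceQuantiles_le_of_one_le hm hb0 hε₁ hγ0.le hγ1 hSQ_markov hSQ_range hK X X' E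
    have hNc := (continualCounting_compl_nearRanks_le hm hε₁ r (wAddRemove m b ε₁ ε₂ γ)).trans
      (ENNReal.ofReal_le_ofReal hK)
    set w := wAddRemove m b ε₁ ε₂ γ
    have hgap := fun i j hij => gap_of_mem_good (by positivity) hrX (i := i) (j := j) hij
    have hgood : ∀ r' ∈ nearRanks r w, r' ∈ Good m X.card (⌈ℓ / 2⌉₊ : ℝ) := fun r' hr' =>
      mem_good_of_nearRanks hrX hr' (fun i => by simp) (fun i j _ => by simp)
    rcases hadj with ⟨x, rfl⟩ | ⟨x, rfl⟩
    · obtain ⟨J, hJ⟩ := exists_oneSubst_add (b := b) hm0 hh hw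
        (fun i j hij => by linarith [hgap i j hij]) x X
      refine roundedSliceQuantiles_le_of_coupling hb0 hγ0.le hSQ_markov hSQ_range
        (α := ε₂) (β := ε₁) (φ := suffixShift J 1) hε₂.le hε₁.le (by linarith) hgood
        (fun r' hr' => mem_good_of_nearRanks hrX' hr' (fun i => ?_) (fun i j hij => ?_))
        (fun r' hr' => releaseAll_le hSQ_markov hε₂.le hSQ_private
          (fun j => slice_mem_inDomain hX _ _) (fun j => slice_mem_inDomain hX' _ _) (hJ r' hr'))
        (map_suffixShift_continualCounting_le hm hε₁ r J (by norm_num)) hNc E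
      · simp only [suffixShift]
        split_ifs <;> simp
      · have := Fin.lt_def.mp hij
        simp only [suffixShift]
        split_ifs <;> omega
    · obtain ⟨J, hJ⟩ := exists_oneSubst_remove (b := b) hm0 hh hw hgap x X'
      refine roundedSliceQuantiles_le_of_coupling hb0 hγ0.le hSQ_markov hSQ_range
        (α := ε₂) (β := ε₁) (φ := suffixShift J (-1)) hε₂.le hε₁.le (by linarith) hgood
        (fun r' hr' => mem_good_of_nearRanks hrX' hr' (fun i => ?_) (fun i j hij => ?_))
        (fun r' hr' => releaseAll_le hSQ_markov hε₂.le hSQ_private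
          (fun j => slice_mem_inDomain hX _ _) (fun j => slice_mem_inDomain hX' _ _) (hJ r' hr'))
        (map_suffixShift_continualCounting_le hm hε₁ r J (by norm_num)) hNc E
      · simp only [suffixShift]
        split_ifs <;> simp
      · have := Fin.lt_def.mp hij
        simp only [suffixShift]
        split_ifs <;> omega
  · rintro X ⟨hX, hrX⟩ X' ⟨hX', hrX'⟩ hadj E -
    have hw_le : 3 * Real.logb 2 m / ε₁ *
        (m * Real.logb 2 b + Real.logb 2 (2 * m / (γ * (Real.exp ε₁ - 1)))) ≤
        wSubstitute m b ε₁ ε₂ γ := by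
      have : 0 ≤ Real.logb 2 m :=
        Real.logb_nonneg (by norm_num) (by exact_mod_cast (by omega : 1 ≤ m))
      exact mul_le_mul_of_nonneg_left (by linarith) (by positivity)
    rcases trivial_or_accurate (K := 2 * ε₁ + 3 * ε₂) hm hb hε₁ hε₁ hγ0 hγ1 hw_le (by linarith)
      with hK | ⟨hw, hK⟩
    · exact roundedSliceQuantiles_le_of_one_le hm hb0 hε₁ hγ0.le hγ1 hSQ_markov hSQ_range hK X X' E
    have hNc := (continualCounting_compl_nearRanks_le hm hε₁ r (wSubstitute m b ε₁ ε₂ γ)).trans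
      (ENNReal.ofReal_le_ofReal hK)
    set w := wSubstitute m b ε₁ ε₂ γ
    have hgap := fun i j hij => gap_of_mem_good (by positivity) hrX (i := i) (j := j) hij
    obtain ⟨Y, x, x', rfl, rfl⟩ := hadj
    have hY : Y ∈ InDomain b := fun y hy => hX y (Multiset.mem_cons_of_mem hy)
    obtain ⟨J, hJ⟩ := exists_oneSubst_remove (b := b) hm0 hh hw hgap x Y
    -- The insertion is coupled around the ranks already shifted by the removal. The intermediate
    -- dataset `Y` need not be admissible, since it enters only through its slices.
    obtain ⟨J', hJ'⟩ := exists_oneSubst_add (b := b) hm0 hh hw (gap_suffixShift_neg hgap J) x' Y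
    refine roundedSliceQuantiles_le_of_coupling hb0 hγ0.le hSQ_markov hSQ_range
      (α := ε₂ + ε₂) (β := ε₁ + ε₁) (φ := suffixShift J' 1 ∘ suffixShift J (-1))
      (N := nearRanks r w) (by linarith) (by linarith) (by linarith)
      (fun r' hr' => mem_good_of_nearRanks hrX hr' (fun i => by simp) (fun i j _ => by simp))
      (fun r' hr' => mem_good_of_nearRanks hrX' hr' (fun i => ?_) (fun i j hij => ?_))
      (fun r' hr' => ?_) ?_ hNc E
    · simp only [suffixShift, Function.comp]
      split_ifs <;> simp
    -- The combined shift is `-1`, `0` or `1` and moves in one direction only along the indices, so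
    -- gaps shrink by at most 1.
    · have := Fin.lt_def.mp hij
      simp only [suffixShift, Function.comp]
      split_ifs <;> omega
    · have h1 := releaseAll_le hSQ_markov hε₂.le hSQ_private
        (fun j => slice_mem_inDomain hX _ _) (fun j => slice_mem_inDomain hY _ _) (hJ r' hr')
      have h2 := releaseAll_le hSQ_markov hε₂.le hSQ_private
        (fun j => slice_mem_inDomain hY _ _) (fun j => slice_mem_inDomain hX' _ _)
        (hJ' _ (suffixShift_mem_nearRanks hr' J (-1)))
      intro F
      rw [Real.exp_add, ENNReal.ofReal_mul (Real.exp_pos _).le, Measure.smul_apply, smul_eq_mul,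
        mul_assoc]
      exact (h1 F).trans (mul_le_mul_right (h2 F) _)
    · rw [← Measure.map_map (measurable_of_countable _) (measurable_of_countable _)]
      intro F
      refine (Measure.map_mono (map_suffixShift_continualCounting_le hm hε₁ r J (by norm_num))
        (measurable_of_countable _) F).trans ?_
      rw [Measure.map_smul, Real.exp_add, ENNReal.ofReal_mul (Real.exp_pos _).le,
        Measure.smul_apply, Measure.smul_apply, smul_eq_mul, smul_eq_mul, mul_assoc]
      exact mul_le_mul_right
        (map_suffixShift_continualCounting_le hm hε₁ r J' (by norm_num) F) _
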